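/- Let $0<\theta<1$ and let $$\alpha_2=\tfrac{\theta+1}{2},\ \alpha_1=-\theta,\ \alpha_0=\tfrac{\theta-1}{2},\qquad \beta_2=\tfrac{2+\theta-\theta^2}{4},\ \beta_1=\tfrac{\theta^2}{2},\ \beta_0=\tfrac{2-\theta-\theta^2}{4}$$ be the coefficients of the Dahlquist–Liniger–Nevanlinna (DLN) method. For a sequence $(z_n)_{n\ge 0}$ and $n\ge1$ write $z_{n,\beta}=\sum_{\ell=0}^2\beta_\ell z_{n-1+\ell}$. **Setting.** Let $\Omega\subset\mathbb R^2$ be a bounded open set (for instance a bounded domain with $C^2$ boundary), let $(\cdot,\cdot)$ and $\|\cdot\|$ be the inner product and norm of $L^2(\Omega)^2$, let $V=\{v\in H_0^1(\Omega)^2:\nabla\cdot v=0\}$, $(\nabla u,\nabla v)=\int_\Omega\sum_{i}\partial_iu\cdot\partial_iv\,dx$ and $b(u,v,w)=\int_\Omega((u\cdot\nabla)v)\cdot w\,dx$. Let $\lambda_1$ be the smallest eigenvalue of the Stokes operator, that is, the smallest $\lambda$ for which there is $0\ne w\in V$ with $(\nabla w,\nabla v)=\lambda(w,v)$ for all $v\in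 V$. Let $\nu,\Delta t>0$, $t_n=n\Delta t$, and let $f\in L^\infty(\mathbb R_+;L^2(\Omega)^2)$ with norm $\|f\|_\infty>0$, represented by a function with $\|f(t)\|\le\|f\|_\infty$ for every $t>0$ (so that its values at the points $t_{n,\beta}$ are meaningful). Let $(u_n)_{n\ge0}\subset H_0^1(\Omega)^2$ be a sequence of velocities of the fully implicit DLN scheme for the Navier–Stokes equations: for all $n\ge1$, $u_{n,\beta}\in V$ and $$\frac1{\Delta t}\Big(\sum_{\ell=0}^2\alpha_\ell u_{n-1+\ell},v\Big)+\nu(\nabla u_{n,\beta},\nabla v)+b(u_{n,\beta},u_{n,\beta},v)=(f(t_{n,\beta}),v)\qquad\forall v\in V .$$ **Constants.** Put $$C_{\Delta t}(\theta,\nu,\lambda)=\frac1{\nu\lambda}\min\Big\{\frac{8\theta(1-\theta^2)}{8-6\theta^2+3\theta^4},\,2(1-\theta)\Big\}$$ and $a_1=-\sqrt{\theta(1-\theta^2)/2}$, $a_2=a_0=-a_1/2$. Call $C_h,C_\epsilon>0$ *admissible* for $\theta$ if for all $\nu,\lambda>0$ and $0<\Delta t<C_{\Delta t}(\theta,\nu,\lambda)$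 there are $\epsilon>0$ and $a,b,c,h_{11},h_{22}\in\mathbb R$ such that for all vectors $x,y,z\in\mathbb{R}^2$ $$\begin{aligned}&\tfrac{1+\theta}4|x|^2+\tfrac{1-\theta}4|y|^2-\tfrac{1+\theta}4|y|^2-\tfrac{1-\theta}4|z|^2+|a_2x+a_1y+a_0z|^2+\tfrac{\nu\Delta t\lambda}{2}|\beta_2x+\beta_1y+\beta_0z|^2\\&\quad=(1+\epsilon)\big(h_{11}|x|^2+h_{22}|y|^2\big)-\big(h_{11}|y|^2+h_{22}|z|^2\big)+|ax+by+cz|^2,\end{aligned}$$ $h_{11}>\frac{\theta^3}2[1-\frac12\theta(1-\theta)]$, $h_{22}>\frac1{16}\theta(1-\theta)^2(1+\theta)(2+\theta)$, $\max\{h_{11},h_{22}\}<C_h$ and $\frac14<\frac1\epsilon<\frac{C_\epsilon}{\nu\lambda\Delta t}$. **Statement.** There are functions $C_h(\theta),C_\epsilon(\theta)$ of $\theta\in(0,1)$ alone, admissible for each $\theta$, such that the following holds for all $\theta,\Omega,\nu,\Delta t,f,(u_n)$ as above. Put $$\widehat C_h=\frac{C_h(\theta)}{\frac{\theta^3}2[1-\frac12\theta(1-\theta)]},\qquad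 \rho_0=\frac{C_\epsilon(\theta)}{\nu^2\lambda_1^2\theta^3[1-\frac12\theta(1-\theta)]}\|f\|_\infty^2 .$$ If $\Delta t<C_{\Delta t}(\theta,\nu,\lambda_1)$ and $N\ge1$ satisfies $$(N-1)\Delta t>T_*:=\frac{4C_\epsilon(\theta)}{\nu\lambda_1}\ln\Big(\frac{\widehat C_h(\|u_1\|^2+\|u_0\|^2)}{\rho_0}\Big)\qquad(\text{with the convention } T_*=0 \text{ if } u_0=u_1=0),$$ then $\|u_N\|^2\le2\rho_0$. Here $\rho_0$ depends only on $\theta,\nu,\lambda_1$ and $\|f\|_\infty$, not on the initial data. -/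

import Mathlib

open MeasureTheory Set
open scoped ENNReal ContDiff

noncomputable section

namespace DLN

/-! ### Function spaces on a plane open set -/

/-- The plane with its Euclidean norm. -/
abbrev Plane : Type := EuclideanSpace ℝ (Fin 2)

/-- Lebesgue measure on `Ω`. -/
abbrev vol (Ω : Set Plane) : Measure Plane := (volume : Measure Plane).restrict Ω

/-- The Hilbert space `L²(Ω)²` of square integrable vector fields on `Ω`, with inner product
`(u, v) = ∫_Ω u · v` and norm `‖u‖ = (u, u)^{1/2}`. -/
abbrev L2 (Ω : Set Plane) : Type := Lp Plane 2 (vol Ω)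

/-- Smooth functions with compact support contained in `Ω`. -/
structure IsTest {F : Type*} [NormedAddCommGroup F] [NormedSpace ℝ F]
    (Ω : Set Plane) (φ : Plane → F) : Prop where
  smooth : ContDiff ℝ ∞ φ
  compact : HasCompactSupport φ
  support : tsupport φ ⊆ Ω

/-- `g` is the weak partial derivative `∂u/∂x_i` of `u` on `Ω`. -/
def HasWeakPartial (Ω : Set Plane) (i : Fin 2) (u g : L2 Ω) : Prop :=
  ∀ φ : Plane → ℝ, IsTest Ω φ →
    ∫ x in Ω, (fderiv ℝ φ x (EuclideanSpace.single i 1)) • u x = - ∫ x in Ω, φ x • g x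

open Classical in
/-- The weak partial derivative `∂u/∂x_i` (with value `0` if `u` has none in `L²(Ω)²`). -/
def pd (Ω : Set Plane) (i : Fin 2) (u : L2 Ω) : L2 Ω :=
  if h : ∃ g, HasWeakPartial Ω i u g then h.choose else 0

/-- `u ∈ H¹(Ω)²`. -/
def MemH1 (Ω : Set Plane) (u : L2 Ω) : Prop :=
  ∀ i, ∃ g, HasWeakPartial Ω i u g

/-- `w` is (the class of) a field in `C_c^∞(Ω)²`. -/
def IsTestField (Ω : Set Plane) (w : L2 Ω) : Prop :=
  ∃ φ : Plane → Plane, IsTest Ω φ ∧ w =ᵐ[vol Ω] φ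

/-- `u ∈ H_0^1(Ω)²`: the closure of `C_c^∞(Ω)²` in `H¹(Ω)²`. -/
def MemH10 (Ω : Set Plane) (u : L2 Ω) : Prop :=
  MemH1 Ω u ∧ ∀ δ : ℝ, 0 < δ →
    ∃ w : L2 Ω, IsTestField Ω w ∧ ‖u - w‖ < δ ∧ ∀ i, ‖pd Ω i u - pd Ω i w‖ < δ

/-- `u ∈ V = {v ∈ H_0^1(Ω)² : ∇ · v = 0}`. -/
def MemV (Ω : Set Plane) (u : L2 Ω) : Prop :=
  MemH10 Ω u ∧ ∀ᵐ x ∂(vol Ω), ∑ i, (pd Ω i u x) i = 0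

/-- `(∇u, ∇v) = ∫_Ω ∑_i ∂_i u · ∂_i v`. -/
def gradInner (Ω : Set Plane) (u v : L2 Ω) : ℝ :=
  ∑ i, inner ℝ (pd Ω i u) (pd Ω i v)

/-- The trilinear form `b(u, v, w) = ((u · ∇) v, w)`. -/
def trilinear (Ω : Set Plane) (u v w : L2 Ω) : ℝ :=
  ∫ x in Ω, inner ℝ (∑ i, (u x i) • pd Ω i v x) (w x)

/-- The eigenvalues of the Stokes operator `A : V → V'`, `⟨Au, v⟩ = (∇u, ∇v)`. -/
def stokesEigenvalues (Ω : Set Plane) : Set ℝ :=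
  {l | ∃ w : L2 Ω, MemV Ω w ∧ w ≠ 0 ∧ ∀ v : L2 Ω, MemV Ω v → gradInner Ω w v = l * inner ℝ w v}

/-- The smallest eigenvalue `λ₁` of the Stokes operator. -/
def lambda1 (Ω : Set Plane) : ℝ := sInf (stokesEigenvalues Ω)

/-- The norm of `f` in `L^∞(ℝ_+; L²(Ω)²)`. -/
def normInf {Ω : Set Plane} (f : ℝ → L2 Ω) : ℝ :=
  (eLpNorm f ∞ ((volume : Measure ℝ).restrict (Ioi 0))).toReal

/-! ### The DLN scheme -/

/-- The coefficients `(α₀, α₁, α₂)`. -/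
def alpha (θ : ℝ) : Fin 3 → ℝ := ![(θ - 1) / 2, -θ, (θ + 1) / 2]

/-- The coefficients `(β₀, β₁, β₂)`. -/
def beta (θ : ℝ) : Fin 3 → ℝ :=
  ![(2 - θ - θ ^ 2) / 4, θ ^ 2 / 2, (2 + θ - θ ^ 2) / 4]

/-- `∑_{ℓ=0}^{2} c_ℓ y_{n+ℓ}`. -/
def comb {F : Type*} [AddCommGroup F] [Module ℝ F] (c : Fin 3 → ℝ) (y : ℕ → F) (n : ℕ) : F :=
  ∑ l : Fin 3, c l • y (n + l)

/-- `u` is a sequence of velocities of the fully implicit DLN scheme with step `Δt` and grid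
`t_n = n Δt`. The step from `u_n, u_{n+1}` to `u_{n+2}` is tested with divergence-free fields,
which eliminates the pressure. -/
structure IsDLNSolution (Ω : Set Plane) (ν Δt θ : ℝ) (f : ℝ → L2 Ω) (u : ℕ → L2 Ω) : Prop where
  mem_H10 : ∀ n, MemH10 Ω (u n)
  div_free : ∀ n, MemV Ω (comb (beta θ) u n)
  momentum : ∀ n, ∀ v : L2 Ω, MemV Ω v →
    1 / Δt * inner ℝ (comb (alpha θ) u n) v
      + ν * gradInner Ω (comb (beta θ) u n) v
      + trilinear Ω (comb (beta θ) u n) (comb (beta θ) u n) v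
      = inner ℝ (f (comb (beta θ) (fun m : ℕ => (m : ℝ) * Δt) n)) v

/-! ### Time step restriction and constants -/

/-- The upper bound for `Δt` in the time step restriction. -/
def dtBound (θ ν lam : ℝ) : ℝ :=
  1 / (ν * lam) *
    min (8 * θ * (1 - θ ^ 2) / (8 - 6 * θ ^ 2 + 3 * θ ^ 4)) (2 * (1 - θ))

/-- The lower bound `θ³/2 [1 - θ(1-θ)/2]` for `h₁₁`. -/
def hLower (θ : ℝ) : ℝ := θ ^ 3 / 2 * (1 - 1 / 2 * θ * (1 - θ))

/-- The weighted squared norm `p ‖x‖² + q ‖y‖²` of the pair `(x, y)`. -/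
def pairNormSq (p q : ℝ) (x y : Plane) : ℝ := p * ‖x‖ ^ 2 + q * ‖y‖ ^ 2

/-- The coefficient `a₁` of the numerical dissipation; the others are `a₂ = a₀ = - a₁ / 2`. -/
def dissip (θ : ℝ) : ℝ := - (√(θ * (1 - θ ^ 2)) / √2)

/-- `Ch = C_h(θ)` and `Ce = C_ε(θ)` are admissible constants in the modified `G`-stability
identity. The identity is stated for vectors `x = u_{n+1}`, `y = u_n`, `z = u_{n-1}` of the plane;
integration over `Ω` turns it into the one for fields. -/
def IsHStabConst (θ Ch Ce : ℝ) : Prop :=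
  0 < Ch ∧ 0 < Ce ∧
  ∀ ν lam Δt : ℝ, 0 < ν → 0 < lam → 0 < Δt → Δt < dtBound θ ν lam →
    ∃ ε a b c h₁₁ h₂₂ : ℝ, 0 < ε ∧
      (∀ x y z : Plane,
        pairNormSq ((1 + θ) / 4) ((1 - θ) / 4) x y - pairNormSq ((1 + θ) / 4) ((1 - θ) / 4) y z
          + ‖(-(dissip θ) / 2) • x + dissip θ • y + (-(dissip θ) / 2) • z‖ ^ 2
          + ν * Δt * lam / 2 * ‖beta θ 2 • x + beta θ 1 • y + beta θ 0 • z‖ ^ 2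
        = (1 + ε) * pairNormSq h₁₁ h₂₂ x y - pairNormSq h₁₁ h₂₂ y z
          + ‖a • x + b • y + c • z‖ ^ 2) ∧
      hLower θ < h₁₁ ∧ 1 / 16 * θ * (1 - θ) ^ 2 * (1 + θ) * (2 + θ) < h₂₂ ∧
      max h₁₁ h₂₂ < Ch ∧ 1 / 4 < 1 / ε ∧ 1 / ε < Ce / (ν * lam * Δt)

/-- `Ĉ_h(θ)`, as a function of `θ` and `C_h(θ)`. -/
def hatC (θ Ch : ℝ) : ℝ := Ch / hLower θ

/-- `ρ₀ = C_ε(θ) ‖f‖_∞² / (ν² λ₁² θ³ [1 - θ(1-θ)/2])`, where `M = ‖f‖_∞`. -/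
def rho0 (θ Ce ν lam M : ℝ) : ℝ :=
  Ce / (ν ^ 2 * lam ^ 2 * θ ^ 3 * (1 - 1 / 2 * θ * (1 - θ))) * M ^ 2

/-- `T_* = (4 C_ε(θ) / (ν λ₁)) ln (Ĉ_h(θ) S / ρ₀)`, where `M = ‖f‖_∞` and
`S = ‖u₁‖² + ‖u₀‖²`. -/
def Tstar (θ Ch Ce ν lam M S : ℝ) : ℝ :=
  4 * Ce / (ν * lam) * Real.log (hatC θ Ch * S / rho0 θ Ce ν lam M)

end DLN

end

/-!
The proof is the discrete energy method. Testing the scheme with `u_{n,β} ∈ V` removes the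
trilinear term, since `b(v, v, v) = 0` on `V` (`trilinear_self_eq_zero`). The Poincaré inequality
`λ₁ ‖v‖² ≤ ‖∇v‖²` on `V` (`lambda1_mul_norm_sq_le`) bounds the viscous term below by
`ν λ₁ ‖u_{n,β}‖²`; one half of this absorbs the force by Young's inequality. The quadratic form in
`u_{n+1}, u_n, u_{n-1}` that the other half and the time difference leave equals
`(1 + ε) H_{n+1} - H_n` plus a square, where `H_{n+1} = h₁₁ ‖u_{n+1}‖² + h₂₂ ‖u_n‖²`; this is the
modified `G`-stability identity, valid in every real inner product space (`exists_stabCoeffs`,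
`StabCoeffs.identity`). Hence `H` contracts by the
factor `1 / (1 + ε)` up to a constant, and `log (1 + ε) ≥ ε / 4` for `ε < 4` converts the rate into
the time `T_*` (`IsDLNSolution.energy_step`, `IsDLNSolution.norm_sq_le`). Comparing coefficients
in the identity gives six equations for its six parameters, which are solved in closed form up to
one quadratic equation.

The two facts about `V` rest on the graph of the gradient: `V` with the `H¹` inner product is a
closed subspace `vJets` of a product of `L²` spaces, in which pairs `(φ, ∇φ)` with test fields `φ`
approximate. For `b(v, v, v) = 0` the last two arguments may be replaced by a test field `φ`, for
which the integrand is `v · ∇(|φ|²/2)`; the passage to the limit uses `H_0^1 ⊂ L⁴`. For the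
Poincaré inequality one needs that the infimum of the Rayleigh quotient is an eigenvalue, hence that
`V` embeds compactly into `L²` (`isCompactOperator_vIncl`). The compactness comes from
`exists_norm_sq_le`: if finitely many balls of radius `s` cover `Ω`, then the `L²` norm of a
function is controlled by its averages over these balls up to `O(s)` times the norm of its
gradient, since translations by `h` move it by at most `|h| ‖∇φ‖` in `L²`.
-/

noncomputable section

namespace DLN

/-! ### The modified `G`-stability identity -/

/-- The `3 × 3` coefficient identities equivalent to the modified `G`-stability identity, together
with the bounds on its parameters; here `K = ν Δt λ / 2`. The bounds `11` and `1201` serve as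
`C_h(θ)` and `C_ε(θ)`; they are far from optimal. -/
structure StabCoeffs (θ K ε a b c h₁₁ h₂₂ : ℝ) : Prop where
  eps_pos : 0 < ε
  xx : (1 + θ) / 4 + θ * (1 - θ ^ 2) / 8 + K * beta θ 2 ^ 2 = (1 + ε) * h₁₁ + a ^ 2
  yy : -θ / 2 + θ * (1 - θ ^ 2) / 2 + K * beta θ 1 ^ 2 = (1 + ε) * h₂₂ - h₁₁ + b ^ 2
  zz : -(1 - θ) / 4 + θ * (1 - θ ^ 2) / 8 + K * beta θ 0 ^ 2 = -h₂₂ + c ^ 2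
  xy : -(θ * (1 - θ ^ 2) / 4) + K * (beta θ 2 * beta θ 1) = a * b
  xz : θ * (1 - θ ^ 2) / 8 + K * (beta θ 2 * beta θ 0) = a * c
  yz : -(θ * (1 - θ ^ 2) / 4) + K * (beta θ 1 * beta θ 0) = b * c
  h11_lower : hLower θ < h₁₁
  h22_lower : 1 / 16 * θ * (1 - θ) ^ 2 * (1 + θ) * (2 + θ) < h₂₂
  h11_upper : h₁₁ < 11
  h22_upper : h₂₂ < 11
  eps_lt : ε < 4
  eps_lower : 2 * K < 1201 * ε

lemma beta_zero (θ : ℝ) : beta θ 0 = (2 - θ - θ ^ 2) / 4 := rfl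
lemma beta_one (θ : ℝ) : beta θ 1 = θ ^ 2 / 2 := rfl
lemma beta_two (θ : ℝ) : beta θ 2 = (2 + θ - θ ^ 2) / 4 := rfl

set_option maxHeartbeats 400000 in
/-- Below the time step bound, the coefficient identities are solvable. The off-diagonal
identities `ab`, `ac`, `bc` determine `a`, `b`, `c` up to a common sign, the `zz` one determines
`h₂₂`, and eliminating `h₁₁` leaves a quadratic equation for `1 + ε`. The latter has a root above
`1` because `(a + b + c)² < K`, which is what the time step restriction is for.

With the factors `P`, `Q`, `R` below, the off-diagonal entries are `a b = -θ (1 + θ) P / 8`,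
`a c = (1 - θ²) Q / 16` and `b c = -θ (1 - θ) R / 8`. -/
theorem exists_stabCoeffs {θ K : ℝ} (h0 : 0 < θ) (h1 : θ < 1) (hK : 0 < K) (hK1 : K < 1 - θ)
    (hK2 : K * (8 - 6 * θ ^ 2 + 3 * θ ^ 4) < 4 * θ * (1 - θ ^ 2)) :
    ∃ ε a b c h₁₁ h₂₂ : ℝ, StabCoeffs θ K ε a b c h₁₁ h₂₂ := by
  have h1' : 0 < 1 - θ := by linarith
  have hθ2 : 0 < 1 - θ ^ 2 := by nlinarith
  obtain ⟨P, hP⟩ : ∃ P, P = 2 * (1 - θ) - K * θ * (2 - θ) := ⟨_, rfl⟩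
  obtain ⟨R, hR⟩ : ∃ R, R = 2 * (1 + θ) - K * θ * (2 + θ) := ⟨_, rfl⟩
  obtain ⟨Q, hQ⟩ : ∃ Q, Q = 2 * θ + K * (4 - θ ^ 2) := ⟨_, rfl⟩
  have hθθ : 0 < θ * (2 - θ) := by nlinarith
  have hθθ1 : θ * (2 - θ) < 1 := by nlinarith
  have hPlow : 1 - θ < P := by
    have : K * (θ * (2 - θ)) < (1 - θ) * 1 := by gcongr
    rw [hP]; linarith
  have hPpos : 0 < P := by linarith
  have hPup : P ≤ 2 * (1 - θ) := by
    have : 0 ≤ K * (θ * (2 - θ)) := by positivity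
    rw [hP]; linarith
  have hRup : R ≤ 2 * (1 + θ) := by
    have : 0 ≤ K * θ * (2 + θ) := by positivity
    rw [hR]; linarith
  have hRpos : 0 < R := by
    have : K * (θ * (2 + θ)) < (1 - θ) * (θ * (2 + θ)) := by gcongr
    rw [hR]; linarith [pow_pos h0 2, pow_pos h0 3]
  have h4 : 0 < 4 - θ ^ 2 := by linarith
  have hQlow : 2 * θ ≤ Q := by
    have : 0 ≤ K * (4 - θ ^ 2) := by positivity
    rw [hQ]; linarith
  have hQpos : 0 < Q := by linarith
  have hKθ : K < θ := by
    have h8 : 5 ≤ 8 - 6 * θ ^ 2 + 3 * θ ^ 4 := by linarith [sq_nonneg (1 - θ ^ 2)]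
    have : K * 5 ≤ K * (8 - 6 * θ ^ 2 + 3 * θ ^ 4) := by gcongr
    linarith [pow_pos h0 3]
  have hQup : Q ≤ 6 * θ := by
    rw [hQ]; linarith [mul_pos hK (pow_pos h0 2)]
  have hPQR : 0 < P * Q * R := by positivity
  obtain ⟨S, hS⟩ : ∃ S, S = √(P * Q * R) := ⟨_, rfl⟩
  have hS2 : S ^ 2 = P * Q * R := by rw [hS, Real.sq_sqrt hPQR.le]
  obtain ⟨a, ha⟩ : ∃ a, a = (1 + θ) * S / (4 * R) := ⟨_, rfl⟩
  obtain ⟨b, hb⟩ : ∃ b, b = -(θ * S / (2 * Q)) := ⟨_, rfl⟩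
  obtain ⟨c, hc⟩ : ∃ c, c = (1 - θ) * S / (4 * P) := ⟨_, rfl⟩
  have ha2 : a ^ 2 = (1 + θ) ^ 2 * (P * Q) / (16 * R) := by
    rw [ha, div_pow, mul_pow, hS2]; field_simp; ring
  have hb2 : b ^ 2 = θ ^ 2 * (P * R) / (4 * Q) := by
    rw [hb, neg_sq, div_pow, mul_pow, hS2]; field_simp; ring
  have hc2 : c ^ 2 = (1 - θ) ^ 2 * (Q * R) / (16 * P) := by
    rw [hc, div_pow, mul_pow, hS2]; field_simp; ring
  have hab : a * b = -((1 + θ) * θ * P / 8) := by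
    have : a * b = -((1 + θ) * θ * S ^ 2 / (8 * Q * R)) := by rw [ha, hb]; field_simp; ring
    rw [this, hS2]; field_simp
  have hac : a * c = (1 + θ) * (1 - θ) * Q / 16 := by
    have : a * c = (1 + θ) * (1 - θ) * S ^ 2 / (16 * P * R) := by rw [ha, hc]; field_simp; ring
    rw [this, hS2]; field_simp
  have hbc : b * c = -((1 - θ) * θ * R / 8) := by
    have : b * c = -((1 - θ) * θ * S ^ 2 / (8 * P * Q)) := by rw [hb, hc]; field_simp; ring
    rw [this, hS2]; field_simp
  obtain ⟨h, hh⟩ : ∃ h, h = c ^ 2 + (1 - θ) / 4 - θ * (1 - θ ^ 2) / 8 - K * beta θ 0 ^ 2 :=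
    ⟨_, rfl⟩
  obtain ⟨A, hA⟩ : ∃ A, A = (1 + θ) / 4 + θ * (1 - θ ^ 2) / 8 + K * beta θ 2 ^ 2 - a ^ 2 :=
    ⟨_, rfl⟩
  obtain ⟨B, hB⟩ : ∃ B, B = -θ / 2 + θ * (1 - θ ^ 2) / 2 + K * beta θ 1 ^ 2 - b ^ 2 := ⟨_, rfl⟩
  -- `h` is `h₂₂`, and `h₁₁ = A / (1 + ε) = h (1 + ε) - B`
  have hhlow : (1 - θ) / 4 ≤ h := by
    have hc2' : (1 - θ) * (Q * R) / 32 ≤ c ^ 2 := by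
      rw [hc2, div_le_div_iff₀ (by norm_num) (by positivity)]
      have : 0 ≤ (1 - θ) * (Q * R) * (2 * (1 - θ) - P) :=
        mul_nonneg (by positivity) (by linarith)
      linarith
    have hk : (1 - θ) * (Q * R) / 32 - θ * (1 - θ ^ 2) / 8 - K * beta θ 0 ^ 2
        = K * θ * ((1 - θ) * (4 - θ ^ 2)) / 32 * (2 - K * (2 + θ)) := by
      rw [hQ, hR, beta_zero]; ring
    have : 0 ≤ K * θ * ((1 - θ) * (4 - θ ^ 2)) / 32 * (2 - K * (2 + θ)) := by
      have : K * (2 + θ) ≤ (1 - θ) * (2 + θ) := by gcongr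
      have : 0 ≤ 2 - K * (2 + θ) := by linarith [sq_nonneg θ]
      positivity
    linarith
  have hhup : h < 2 := by
    have hc2' : c ^ 2 ≤ (1 - θ) * (Q * R) / 16 := by
      rw [hc2, div_le_div_iff₀ (by positivity) (by norm_num)]
      have : 0 ≤ (1 - θ) * (Q * R) * (P - (1 - θ)) := mul_nonneg (by positivity) (by linarith)
      linarith
    have : (1 - θ) * (Q * R) ≤ 1 * ((6 * 1) * (2 * (1 + 1))) := by
      gcongr
      · linarith
      · linarith
      · linarith
    have : 0 ≤ K * beta θ 0 ^ 2 := by positivity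
    have : 0 ≤ θ * (1 - θ ^ 2) := by positivity
    linarith
  -- bounds for `B`
  have hBup : B < -hLower θ := by
    have : 0 ≤ b ^ 2 := sq_nonneg b
    have : K * θ ^ 4 < (1 - θ) * θ ^ 4 := by gcongr
    rw [hB, beta_one, hLower]
    linarith
  have hBlow : -(1 / 2) ≤ B := by
    have hb2' : b ^ 2 ≤ θ * (1 - θ ^ 2) / 2 := by
      have hPR : P * R ≤ (2 * (1 - θ)) * (2 * (1 + θ)) := by gcongr
      rw [hb2, div_le_div_iff₀ (by positivity) (by norm_num)]
      calc θ ^ 2 * (P * R) * 2 ≤ θ ^ 2 * ((2 * (1 - θ)) * (2 * (1 + θ))) * 2 := by gcongr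
        _ = θ * (1 - θ ^ 2) * (4 * (2 * θ)) := by ring
        _ ≤ θ * (1 - θ ^ 2) * (4 * Q) := by gcongr
    have : 0 ≤ K * beta θ 1 ^ 2 := by positivity
    rw [hB]; linarith
  -- the gain `κ = K - (a + b + c)²`
  obtain ⟨κ, hκ⟩ : ∃ κ, κ = A + B - h := ⟨_, rfl⟩
  have hκK : κ = K - (a + b + c) ^ 2 := by
    have : (a + b + c) ^ 2 = a ^ 2 + b ^ 2 + c ^ 2 + 2 * (a * b + a * c + b * c) := by ring
    rw [this, hab, hac, hbc, hκ, hA, hB, hh, beta_zero, beta_one, beta_two, hP, hQ, hR]; ring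
  have hκup : κ ≤ 1 - θ := by linarith [sq_nonneg (a + b + c)]
  -- `κ P Q R = K θ (8 (1 - θ²) - 3 K θ (4 - θ²))`; the first part of the time step restriction
  -- bounds the last factor below by `(1 - θ²) / 2`, because
  -- `8 (8 - 6 θ² + 3 θ⁴) - 12 θ² (4 - θ²) = (8 - 6 θ²)²`
  have hκlow : K / 48 ≤ κ := by
    have hform : κ = K * θ * (8 * (1 - θ ^ 2) - 3 * K * θ * (4 - θ ^ 2)) / (P * Q * R) := by
      have : a + b + c
          = S / (4 * (P * Q * R)) * ((1 + θ) * (P * Q) - 2 * θ * (P * R) + (1 - θ) * (Q * R)) := by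
        rw [ha, hb, hc]; field_simp; ring
      rw [hκK, this, mul_pow, div_pow, hS2]
      field_simp
      rw [hP, hQ, hR]; ring
    rw [hform, le_div_iff₀ hPQR]
    have hPQR' : P * Q * R ≤ (2 * (1 - θ)) * (6 * θ) * (2 * (1 + θ)) := by gcongr
    have h3 : (1 - θ ^ 2) / 2 ≤ 8 * (1 - θ ^ 2) - 3 * K * θ * (4 - θ ^ 2) := by
      have hpos : 0 < 8 - 6 * θ ^ 2 + 3 * θ ^ 4 := by linarith [sq_nonneg (1 - θ ^ 2)]
      have h5 : 3 * θ * (4 - θ ^ 2) * (K * (8 - 6 * θ ^ 2 + 3 * θ ^ 4))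
          ≤ 3 * θ * (4 - θ ^ 2) * (4 * θ * (1 - θ ^ 2)) := by gcongr
      have h6 : 0 ≤ (1 - θ ^ 2) * ((8 - 6 * θ ^ 2) ^ 2
          - (8 - 6 * θ ^ 2 + 3 * θ ^ 4) / 2) := by
        refine mul_nonneg hθ2.le ?_
        have : (2 : ℝ) ^ 2 ≤ (8 - 6 * θ ^ 2) ^ 2 := by gcongr; linarith
        linarith [mul_pos (pow_pos h0 2) hθ2, pow_pos h0 2]
      refine le_of_mul_le_mul_right ?_ hpos
      linarith
    calc K / 48 * (P * Q * R) ≤ K / 48 * ((2 * (1 - θ)) * (6 * θ) * (2 * (1 + θ))) := by gcongr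
      _ = K * θ * ((1 - θ ^ 2) / 2) := by ring
      _ ≤ _ := by gcongr
  have hκpos : 0 < κ := lt_of_lt_of_le (by positivity) hκlow
  have hhpos : 0 < h := by linarith
  have hLpos : 0 < hLower θ := by
    rw [hLower]
    have : 0 < 1 - 1 / 2 * θ * (1 - θ) := by linarith [sq_nonneg θ]
    positivity
  -- the root `1 + ε` of `h s² - B s - A`
  obtain ⟨s, ⟨hs1, hs5⟩, hs⟩ : ∃ s ∈ Ioo (1 : ℝ) 5, h * s ^ 2 - B * s - A = 0 := by
    have hcont : ContinuousOn (fun s : ℝ => h * s ^ 2 - B * s - A) (Icc 1 5) := by fun_prop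
    refine intermediate_value_Ioo (by norm_num) hcont ⟨?_, ?_⟩
    · change h * 1 ^ 2 - B * 1 - A < 0
      linarith
    · change 0 < h * 5 ^ 2 - B * 5 - A
      linarith
  refine ⟨s - 1, a, b, c, h * s - B, h,
    ⟨by linarith, ?_, ?_, ?_, ?_, ?_, ?_, ?_, ?_, ?_, ?_, ?_, ?_⟩⟩
  · linear_combination -hs - hA
  · rw [hB]; ring
  · rw [hh]; ring
  · rw [hab, hP, beta_two, beta_one]; ring
  · rw [hac, hQ, beta_two, beta_zero]; ring
  · rw [hbc, hR, beta_one, beta_zero]; ring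
  · have : 0 ≤ h * s := by positivity
    linarith
  · have hθ4 : θ * (1 - θ) < 1 / 3 := by linarith [sq_nonneg (2 * θ - 1)]
    calc 1 / 16 * θ * (1 - θ) ^ 2 * (1 + θ) * (2 + θ)
        = (θ * (1 - θ)) * ((1 + θ) * (2 + θ)) * (1 - θ) / 16 := by ring
      _ < (1 / 3) * ((1 + 1) * (2 + 1)) * (1 - θ) / 16 := by gcongr
      _ ≤ h := by linarith
  · have : h * s < 2 * 5 := by gcongr
    linarith
  · linarith
  · linarith
  -- the equation for `s` reads `ε (2 h - B + h ε) = κ`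
  · have hε : (s - 1) * (2 * h - B + h * (s - 1)) = κ := by rw [hκ]; linear_combination hs
    have h7 : 2 * h - B + h * (s - 1) ≤ 25 / 2 := by
      have : h * (s - 1) ≤ 2 * 4 := by gcongr; linarith
      linarith
    have : (s - 1) * (2 * h - B + h * (s - 1)) ≤ (s - 1) * (25 / 2) := by gcongr
    linarith

lemma norm_sq_add_three {E : Type*} [NormedAddCommGroup E] [InnerProductSpace ℝ E]
    (p q r : ℝ) (x y z : E) :
    ‖p • x + q • y + r • z‖ ^ 2 = p ^ 2 * ‖x‖ ^ 2 + q ^ 2 * ‖y‖ ^ 2 + r ^ 2 * ‖z‖ ^ 2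
      + 2 * (p * q) * inner ℝ x y + 2 * (p * r) * inner ℝ x z + 2 * (q * r) * inner ℝ y z := by
  rw [norm_add_sq_real, norm_add_sq_real, norm_smul, norm_smul, norm_smul, mul_pow, mul_pow,
    mul_pow, inner_add_left]
  simp only [real_inner_smul_left, real_inner_smul_right, Real.norm_eq_abs, sq_abs]
  ring

lemma dissip_sq {θ : ℝ} (h0 : 0 < θ) (h1 : θ < 1) : dissip θ ^ 2 = θ * (1 - θ ^ 2) / 2 := by
  have : 0 ≤ θ * (1 - θ ^ 2) := mul_nonneg h0.le (by nlinarith)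
  rw [dissip, neg_sq, div_pow, Real.sq_sqrt this, Real.sq_sqrt (by norm_num)]

/-- The modified `G`-stability identity in an arbitrary real inner product space. -/
theorem StabCoeffs.identity {θ K ε a b c h₁₁ h₂₂ : ℝ} (h0 : 0 < θ) (h1 : θ < 1)
    (h : StabCoeffs θ K ε a b c h₁₁ h₂₂)
    {E : Type*} [NormedAddCommGroup E] [InnerProductSpace ℝ E] (x y z : E) :
    ((1 + θ) / 4 * ‖x‖ ^ 2 + (1 - θ) / 4 * ‖y‖ ^ 2)
        - ((1 + θ) / 4 * ‖y‖ ^ 2 + (1 - θ) / 4 * ‖z‖ ^ 2)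
        + ‖(-(dissip θ) / 2) • x + dissip θ • y + (-(dissip θ) / 2) • z‖ ^ 2
        + K * ‖beta θ 2 • x + beta θ 1 • y + beta θ 0 • z‖ ^ 2
      = (1 + ε) * (h₁₁ * ‖x‖ ^ 2 + h₂₂ * ‖y‖ ^ 2) - (h₁₁ * ‖y‖ ^ 2 + h₂₂ * ‖z‖ ^ 2)
        + ‖a • x + b • y + c • z‖ ^ 2 := by
  have hd := dissip_sq h0 h1
  rw [norm_sq_add_three, norm_sq_add_three, norm_sq_add_three]
  linear_combination (‖x‖ ^ 2 / 4 + ‖y‖ ^ 2 + ‖z‖ ^ 2 / 4 - inner ℝ x y + inner ℝ x z / 2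
    - inner ℝ y z) * hd + ‖x‖ ^ 2 * h.xx + ‖y‖ ^ 2 * h.yy + ‖z‖ ^ 2 * h.zz
    + 2 * inner ℝ x y * h.xy + 2 * inner ℝ x z * h.xz + 2 * inner ℝ y z * h.yz

/-- `G`-stability of the DLN method. -/
theorem inner_alpha_beta {θ : ℝ} (h0 : 0 < θ) (h1 : θ < 1)
    {E : Type*} [NormedAddCommGroup E] [InnerProductSpace ℝ E] (x y z : E) :
    inner ℝ (((θ + 1) / 2) • x + (-θ) • y + ((θ - 1) / 2) • z)
        (beta θ 2 • x + beta θ 1 • y + beta θ 0 • z)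
      = ((1 + θ) / 4 * ‖x‖ ^ 2 + (1 - θ) / 4 * ‖y‖ ^ 2)
        - ((1 + θ) / 4 * ‖y‖ ^ 2 + (1 - θ) / 4 * ‖z‖ ^ 2)
        + ‖(-(dissip θ) / 2) • x + dissip θ • y + (-(dissip θ) / 2) • z‖ ^ 2 := by
  have hd := dissip_sq h0 h1
  rw [norm_sq_add_three]
  simp only [inner_add_left, inner_add_right, real_inner_smul_left, real_inner_smul_right,
    real_inner_self_eq_norm_sq, beta_zero, beta_one, beta_two]
  rw [real_inner_comm y x, real_inner_comm z x, real_inner_comm z y]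
  linear_combination -(‖x‖ ^ 2 / 4 + ‖y‖ ^ 2 + ‖z‖ ^ 2 / 4 - inner ℝ y x + inner ℝ z x / 2
    - inner ℝ z y) * hd

lemma exists_stabCoeffs_of_lt_dtBound {θ ν lam Δt : ℝ} (h0 : 0 < θ) (h1 : θ < 1) (hν : 0 < ν)
    (hlam : 0 < lam) (hΔt : 0 < Δt) (hlt : Δt < dtBound θ ν lam) :
    ∃ ε a b c h₁₁ h₂₂ : ℝ, StabCoeffs θ (ν * Δt * lam / 2) ε a b c h₁₁ h₂₂ := by
  rw [dtBound, one_div, ← div_eq_inv_mul, lt_div_iff₀ (by positivity)] at hlt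
  obtain ⟨hl1, hl2⟩ := lt_min_iff.mp hlt
  have hpos : 0 < 8 - 6 * θ ^ 2 + 3 * θ ^ 4 := by linarith [sq_nonneg (1 - θ ^ 2)]
  rw [lt_div_iff₀ hpos] at hl1
  exact exists_stabCoeffs h0 h1 (by positivity) (by linarith) (by linarith)

theorem isHStabConst {θ : ℝ} (h0 : 0 < θ) (h1 : θ < 1) : IsHStabConst θ 11 1201 := by
  refine ⟨by norm_num, by norm_num, fun ν lam Δt hν hlam hΔt hlt => ?_⟩
  obtain ⟨ε, a, b, c, h₁₁, h₂₂, h⟩ := exists_stabCoeffs_of_lt_dtBound h0 h1 hν hlam hΔt hlt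
  have hε := h.eps_pos
  refine ⟨ε, a, b, c, h₁₁, h₂₂, hε, fun x y z => h.identity h0 h1 x y z, h.h11_lower,
    h.h22_lower, max_lt h.h11_upper h.h22_upper, ?_, ?_⟩
  · exact one_div_lt_one_div_of_lt hε h.eps_lt
  · rw [div_lt_div_iff₀ hε (by positivity)]
    have := h.eps_lower
    linarith

/-! ### The discrete energy estimate -/

lemma comb_eq {F : Type*} [AddCommGroup F] [Module ℝ F] (c : Fin 3 → ℝ) (y : ℕ → F) (n : ℕ) :
    comb c y n = c 2 • y (n + 2) + c 1 • y (n + 1) + c 0 • y n := by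
  simp only [comb, Fin.sum_univ_three]
  change c 0 • y (n + 0) + c 1 • y (n + 1) + c 2 • y (n + 2) = _
  rw [add_zero]; abel

/-- The time at which the force is evaluated is positive. -/
lemma comb_beta_time_pos {θ Δt : ℝ} (h0 : 0 < θ) (hΔt : 0 < Δt) (n : ℕ) :
    0 < comb (beta θ) (fun m : ℕ => (m : ℝ) * Δt) n := by
  rw [comb_eq, beta_zero, beta_one, beta_two]
  have : (0 : ℝ) ≤ n * Δt := by positivity
  have h2 : 0 < (2 + θ) / 2 * Δt := by positivity
  simp only [smul_eq_mul]
  push_cast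
  nlinarith

/-- One step of the scheme: testing with `u_{n,β}` turns the modified `G`-stability identity into
a contraction of the `h`-weighted norm, up to the contribution of the force. -/
theorem IsDLNSolution.energy_step {θ ν Δt lam M : ℝ} {Ω : Set Plane} {f : ℝ → L2 Ω} {u : ℕ → L2 Ω}
    (h0 : 0 < θ) (h1 : θ < 1) (hν : 0 < ν) (hΔt : 0 < Δt) (hlam : 0 < lam)
    (hpoincare : ∀ v, MemV Ω v → lam * ‖v‖ ^ 2 ≤ gradInner Ω v v)
    (hskew : ∀ v, MemV Ω v → trilinear Ω v v v = 0)
    (hf : ∀ t : ℝ, 0 < t → ‖f t‖ ≤ M) (hu : IsDLNSolution Ω ν Δt θ f u)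
    {ε a b c h₁₁ h₂₂ : ℝ} (h : StabCoeffs θ (ν * Δt * lam / 2) ε a b c h₁₁ h₂₂) (n : ℕ) :
    (1 + ε) * (h₁₁ * ‖u (n + 2)‖ ^ 2 + h₂₂ * ‖u (n + 1)‖ ^ 2)
      ≤ h₁₁ * ‖u (n + 1)‖ ^ 2 + h₂₂ * ‖u n‖ ^ 2 + Δt * M ^ 2 / (2 * ν * lam) := by
  have hV := hu.div_free n
  have hmom := hu.momentum n _ hV
  have hP := hpoincare _ hV
  rw [hskew _ hV] at hmom
  have hforce := (real_inner_le_norm (f (comb (beta θ) (fun m : ℕ => (m : ℝ) * Δt) n))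
    (comb (beta θ) u n)).trans (mul_le_mul_of_nonneg_right
      (hf _ (comb_beta_time_pos h0 hΔt n)) (norm_nonneg _))
  have hG := inner_alpha_beta h0 h1 (u (n + 2)) (u (n + 1)) (u n)
  have hI := h.identity h0 h1 (u (n + 2)) (u (n + 1)) (u n)
  have hα : comb (alpha θ) u n
      = ((θ + 1) / 2) • u (n + 2) + (-θ) • u (n + 1) + ((θ - 1) / 2) • u n := comb_eq _ _ _
  rw [← comb_eq] at hG hI
  rw [← hα] at hG
  rw [← hmom] at hforce
  set w := comb (beta θ) u n
  have hyoung : M * ‖w‖ ≤ ν * lam / 2 * ‖w‖ ^ 2 + M ^ 2 / (2 * ν * lam) := by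
    have : ν * lam / 2 * ‖w‖ ^ 2 + M ^ 2 / (2 * ν * lam) - M * ‖w‖
        = (ν * lam * ‖w‖ - M) ^ 2 / (2 * ν * lam) := by field_simp; ring
    have : 0 ≤ (ν * lam * ‖w‖ - M) ^ 2 / (2 * ν * lam) := by positivity
    linarith
  have hνP : ν * (lam * ‖w‖ ^ 2) ≤ ν * gradInner Ω w w := by gcongr
  have hmain : 1 / Δt * inner ℝ (comb (alpha θ) u n) w
      ≤ M ^ 2 / (2 * ν * lam) - ν * lam / 2 * ‖w‖ ^ 2 := by linarith
  have hmain' : inner ℝ (comb (alpha θ) u n) w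
      ≤ Δt * M ^ 2 / (2 * ν * lam) - ν * Δt * lam / 2 * ‖w‖ ^ 2 := by
    have := mul_le_mul_of_nonneg_left hmain hΔt.le
    have e1 : Δt * (1 / Δt * inner ℝ (comb (alpha θ) u n) w)
        = inner ℝ (comb (alpha θ) u n) w := by field_simp
    rw [e1] at this
    linarith [this, mul_div_assoc Δt (M ^ 2) (2 * ν * lam)]
  have hsq : 0 ≤ ‖a • u (n + 2) + b • u (n + 1) + c • u n‖ ^ 2 := by positivity
  linarith

lemma le_of_contraction {H : ℕ → ℝ} {ε F : ℝ} (hε : 0 < ε)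
    (hH : ∀ n, (1 + ε) * H (n + 1) ≤ H n + F) (hF : 0 ≤ F) (n : ℕ) :
    H n ≤ F / ε + H 0 / (1 + ε) ^ n := by
  induction n with
  | zero => simp; positivity
  | succ n ih =>
    have h1 : 0 < 1 + ε := by linarith
    have h2 : (1 + ε) * (F / ε + H 0 / (1 + ε) ^ (n + 1)) = F / ε + H 0 / (1 + ε) ^ n + F := by
      field_simp; ring
    refine le_of_mul_le_mul_left ?_ h1
    rw [h2]
    linarith [hH n]

/-- The absorbing ball, given the Poincaré inequality with constant `lam` on `V` and the
skew-symmetry of the trilinear form. -/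
theorem IsDLNSolution.norm_sq_le {θ ν Δt lam M : ℝ} {Ω : Set Plane} {f : ℝ → L2 Ω} {u : ℕ → L2 Ω}
    (h0 : 0 < θ) (h1 : θ < 1) (hν : 0 < ν) (hΔt : 0 < Δt) (hlam : 0 < lam) (hM : 0 < M)
    (hpoincare : ∀ v, MemV Ω v → lam * ‖v‖ ^ 2 ≤ gradInner Ω v v)
    (hskew : ∀ v, MemV Ω v → trilinear Ω v v v = 0)
    (hf : ∀ t : ℝ, 0 < t → ‖f t‖ ≤ M) (hu : IsDLNSolution Ω ν Δt θ f u)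
    (hlt : Δt < dtBound θ ν lam) (n : ℕ)
    (hn : n * Δt > Tstar θ 11 1201 ν lam M (‖u 1‖ ^ 2 + ‖u 0‖ ^ 2)) :
    ‖u (n + 1)‖ ^ 2 ≤ 2 * rho0 θ 1201 ν lam M := by
  obtain ⟨ε, a, b, c, h₁₁, h₂₂, h⟩ := exists_stabCoeffs_of_lt_dtBound h0 h1 hν hlam hΔt hlt
  have hε := h.eps_pos
  have hL : 0 < hLower θ := by
    rw [hLower]
    have : 0 < 1 - 1 / 2 * θ * (1 - θ) := by nlinarith
    positivity
  have hρL : hLower θ * rho0 θ 1201 ν lam M = 1201 * M ^ 2 / (2 * ν ^ 2 * lam ^ 2) := by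
    have : 0 < 1 - 1 / 2 * θ * (1 - θ) := by nlinarith
    rw [hLower, rho0]
    generalize 1 - 1 / 2 * θ * (1 - θ) = t at this ⊢
    field_simp
  have hρ : 0 < rho0 θ 1201 ν lam M := by
    refine pos_of_mul_pos_right (a := hLower θ) ?_ hL.le
    rw [hρL]; positivity
  have h22 : 0 ≤ h₂₂ := le_trans (by have : 0 < 1 - θ := by linarith
                                     positivity) h.h22_lower.le
  have hdecay := le_of_contraction (H := fun n => h₁₁ * ‖u (n + 1)‖ ^ 2 + h₂₂ * ‖u n‖ ^ 2) hε
    (fun n => hu.energy_step h0 h1 hν hΔt hlam hpoincare hskew hf h n) (by positivity) n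
  have hεlow := h.eps_lower
  have hforce : Δt * M ^ 2 / (2 * ν * lam) / ε ≤ hLower θ * rho0 θ 1201 ν lam M := by
    rw [hρL, div_div, div_le_div_iff₀ (by positivity) (by positivity)]
    have : ν * Δt * lam ≤ 1201 * ε := by linarith
    calc Δt * M ^ 2 * (2 * ν ^ 2 * lam ^ 2) = M ^ 2 * (2 * ν * lam) * (ν * Δt * lam) := by ring
      _ ≤ M ^ 2 * (2 * ν * lam) * (1201 * ε) := by gcongr
      _ = _ := by ring
  have hinit : (h₁₁ * ‖u 1‖ ^ 2 + h₂₂ * ‖u 0‖ ^ 2) / (1 + ε) ^ n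
      ≤ hLower θ * rho0 θ 1201 ν lam M := by
    rw [div_le_iff₀ (by positivity)]
    have hS : h₁₁ * ‖u 1‖ ^ 2 + h₂₂ * ‖u 0‖ ^ 2 ≤ 11 * (‖u 1‖ ^ 2 + ‖u 0‖ ^ 2) := by
      rw [mul_add]
      have := h.h11_upper.le
      have := h.h22_upper.le
      gcongr
    refine hS.trans ?_
    have hSnn : 0 ≤ ‖u 1‖ ^ 2 + ‖u 0‖ ^ 2 := by positivity
    set S := ‖u 1‖ ^ 2 + ‖u 0‖ ^ 2
    rcases hSnn.eq_or_lt with hS0 | hSpos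
    · rw [← hS0, mul_zero]; positivity
    have hY : 0 < hatC θ 11 * S / rho0 θ 1201 ν lam M := by rw [hatC]; positivity
    have hlog : Real.log (hatC θ 11 * S / rho0 θ 1201 ν lam M) ≤ n * Real.log (1 + ε) := by
      have h3 : ε / 4 ≤ Real.log (1 + ε) := by
        refine le_trans ?_ (Real.le_log_one_add_of_nonneg hε.le)
        rw [div_le_div_iff₀ (by norm_num) (by linarith)]
        nlinarith [h.eps_lt]
      have h4 : Real.log (hatC θ 11 * S / rho0 θ 1201 ν lam M)
          ≤ n * (ν * Δt * lam / (4 * 1201)) := by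
        rw [Tstar, gt_iff_lt, div_mul_eq_mul_div, div_lt_iff₀ (by positivity)] at hn
        linarith
      refine h4.trans ?_
      gcongr
      linarith
    rw [← Real.log_pow, Real.log_le_log_iff hY (by positivity), div_le_iff₀ hρ, hatC,
      div_mul_eq_mul_div, div_le_iff₀ hL] at hlog
    linarith
  have h11 : hLower θ * ‖u (n + 1)‖ ^ 2 ≤ h₁₁ * ‖u (n + 1)‖ ^ 2 := by
    have := h.h11_lower.le
    gcongr
  have h22' : 0 ≤ h₂₂ * ‖u n‖ ^ 2 := by positivity
  refine le_of_mul_le_mul_left ?_ hL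
  simp only [zero_add] at hdecay
  linarith

variable {Ω : Set Plane}

/-! ### Weak partial derivatives -/

section Test

variable {F : Type*} [NormedAddCommGroup F] [NormedSpace ℝ F] {φ ψ : Plane → F}

lemma IsTest.add (hφ : IsTest Ω φ) (hψ : IsTest Ω ψ) : IsTest Ω (φ + ψ) where
  smooth := hφ.smooth.add hψ.smooth
  compact := hφ.compact.add hψ.compact
  support := (tsupport_add φ ψ).trans (union_subset hφ.support hψ.support)

lemma IsTest.const_smul (c : ℝ) (hφ : IsTest Ω φ) : IsTest Ω (c • φ) where
  smooth := contDiff_const.smul hφ.smooth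
  compact := hφ.compact.smul_left (f := fun _ => c)
  support := (closure_mono (Function.support_const_smul_subset c φ)).trans hφ.support

lemma isTest_zero : IsTest Ω (0 : Plane → F) where
  smooth := contDiff_const
  compact := HasCompactSupport.zero
  support := by simp [tsupport]

lemma IsTest.fderiv_apply (hφ : IsTest Ω φ) (v : Plane) : IsTest Ω (fun x => fderiv ℝ φ x v) where
  smooth := (hφ.smooth.fderiv_right (m := ∞) (by simp)).clm_apply contDiff_const
  compact := hφ.compact.fderiv_apply ℝ v
  support := (tsupport_fderiv_apply_subset ℝ v).trans hφ.support

lemma IsTest.memLp (hφ : IsTest Ω φ) (p : ℝ≥0∞) (μ : Measure Plane) [IsFiniteMeasureOnCompacts μ] :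
    MemLp φ p μ :=
  hφ.smooth.continuous.memLp_of_hasCompactSupport hφ.compact

lemma IsTest.eq_zero_of_notMem (hφ : IsTest Ω φ) {x : Plane} (hx : x ∉ Ω) : φ x = 0 :=
  image_eq_zero_of_notMem_tsupport fun h => hx (hφ.support h)

end Test

/-- Integration against a fixed scalar function in `L²(Ω)`. -/
def integralSMul (ψ : Lp ℝ 2 (vol Ω)) : L2 Ω →L[ℝ] Plane :=
  (ContinuousLinearMap.lsmul ℝ ℝ).lpPairing (vol Ω) 2 2 ψ

lemma integralSMul_toLp {ψ : Plane → ℝ} (hψ : MemLp ψ 2 (vol Ω)) (u : L2 Ω) :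
    integralSMul (hψ.toLp ψ) u = ∫ x in Ω, ψ x • u x := by
  rw [integralSMul, ContinuousLinearMap.lpPairing_eq_integral]
  refine integral_congr_ae ?_
  filter_upwards [hψ.coeFn_toLp] with x hx
  simp [hx]

lemma hasWeakPartial_iff {i : Fin 2} {u g : L2 Ω} :
    HasWeakPartial Ω i u g ↔ ∀ φ : Plane → ℝ, ∀ hφ : IsTest Ω φ,
      integralSMul (((hφ.fderiv_apply (EuclideanSpace.single i 1)).memLp 2 (vol Ω)).toLp _) u
        + integralSMul ((hφ.memLp 2 (vol Ω)).toLp _) g = 0 := by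
  refine forall_congr' fun φ => forall_congr' fun hφ => ?_
  rw [integralSMul_toLp, integralSMul_toLp, eq_neg_iff_add_eq_zero]

lemma HasWeakPartial.add {i : Fin 2} {u g v h : L2 Ω} (hu : HasWeakPartial Ω i u g)
    (hv : HasWeakPartial Ω i v h) : HasWeakPartial Ω i (u + v) (g + h) := by
  rw [hasWeakPartial_iff] at *
  intro φ hφ
  rw [map_add, map_add, add_add_add_comm, hu φ hφ, hv φ hφ, add_zero]

lemma HasWeakPartial.const_smul {i : Fin 2} {u g : L2 Ω} (c : ℝ) (hu : HasWeakPartial Ω i u g) :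
    HasWeakPartial Ω i (c • u) (c • g) := by
  rw [hasWeakPartial_iff] at *
  intro φ hφ
  rw [map_smul, map_smul, ← smul_add, hu φ hφ, smul_zero]

lemma hasWeakPartial_zero (i : Fin 2) : HasWeakPartial Ω i (0 : L2 Ω) 0 := by
  rw [hasWeakPartial_iff]
  simp

lemma isClosed_hasWeakPartial (i : Fin 2) :
    IsClosed {x : L2 Ω × L2 Ω | HasWeakPartial Ω i x.1 x.2} := by
  simp only [hasWeakPartial_iff, ofPred_forall]
  exact isClosed_iInter fun φ => isClosed_iInter fun hφ =>
    isClosed_eq (by fun_prop) continuous_const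

lemma HasWeakPartial.unique (hΩ : IsOpen Ω) {i : Fin 2} {u g h : L2 Ω}
    (hg : HasWeakPartial Ω i u g) (hh : HasWeakPartial Ω i u h) : g = h := by
  have hsub := hg.add (hh.const_smul (-1))
  rw [neg_one_smul, neg_one_smul, add_neg_cancel, ← sub_eq_add_neg] at hsub
  rw [← sub_eq_zero]
  have hint : LocallyIntegrableOn (g - h : L2 Ω) Ω volume :=
    locallyIntegrableOn_of_locallyIntegrable_restrict
      ((Lp.memLp (g - h)).locallyIntegrable (by norm_num))
  have hae := hΩ.ae_eq_zero_of_integral_contDiff_smul_eq_zero hint fun φ h1 h2 h3 => by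
    have := hsub φ ⟨h1, h2, h3⟩
    rw [← setIntegral_eq_integral_of_forall_compl_eq_zero (s := Ω), ← neg_eq_zero, ← this]
    · refine (integral_congr_ae ?_).trans (integral_zero _ _)
      filter_upwards [Lp.coeFn_zero Plane 2 (vol Ω)] with x hx
      rw [hx, Pi.zero_apply, smul_zero]
    · intro x hx
      rw [image_eq_zero_of_notMem_tsupport fun h => hx (h3 h), zero_smul]
  rw [Lp.eq_zero_iff_ae_eq_zero]
  exact (ae_restrict_iff' hΩ.measurableSet).mpr hae

lemma HasWeakPartial.pd_eq (hΩ : IsOpen Ω) {i : Fin 2} {u g : L2 Ω} (hg : HasWeakPartial Ω i u g) :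
    pd Ω i u = g := by
  have h : ∃ g, HasWeakPartial Ω i u g := ⟨g, hg⟩
  rw [pd, dif_pos h]
  exact h.choose_spec.unique hΩ hg

lemma MemH1.hasWeakPartial {u : L2 Ω} (hu : MemH1 Ω u) (i : Fin 2) :
    HasWeakPartial Ω i u (pd Ω i u) := by
  rw [pd, dif_pos (hu i)]
  exact (hu i).choose_spec

/-- For a test field the weak partial derivatives are the classical ones. -/
lemma IsTest.hasWeakPartial {φ : Plane → Plane} (hφ : IsTest Ω φ) (i : Fin 2) {w g : L2 Ω}
    (hw : w =ᵐ[vol Ω] φ) (hg : g =ᵐ[vol Ω] fun x => fderiv ℝ φ x (EuclideanSpace.single i 1)) :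
    HasWeakPartial Ω i w g := by
  intro ψ hψ
  have hψ' := hψ.fderiv_apply (EuclideanSpace.single i 1)
  have hφ' := hφ.fderiv_apply (EuclideanSpace.single i 1)
  have hint : ∀ {a : Plane → ℝ} {b : Plane → Plane}, IsTest Ω a → IsTest Ω b →
      Integrable (fun x => a x • b x) := fun ha hb =>
    (ha.smooth.continuous.smul hb.smooth.continuous).integrable_of_hasCompactSupport
      (ha.compact.smul_right (f' := _))
  have h1 : ∫ x in Ω, fderiv ℝ ψ x (EuclideanSpace.single i 1) • w x
      = ∫ x, fderiv ℝ ψ x (EuclideanSpace.single i 1) • φ x := by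
    refine Eq.trans ?_ (setIntegral_eq_integral_of_forall_compl_eq_zero (s := Ω) ?_)
    · refine integral_congr_ae ?_
      filter_upwards [hw] with x hx
      rw [hx]
    · intro x hx
      rw [hφ.eq_zero_of_notMem hx, smul_zero]
  have h2 : ∫ x in Ω, ψ x • g x = ∫ x, ψ x • fderiv ℝ φ x (EuclideanSpace.single i 1) := by
    refine Eq.trans ?_ (setIntegral_eq_integral_of_forall_compl_eq_zero (s := Ω) ?_)
    · refine integral_congr_ae ?_
      filter_upwards [hg] with x hx
      rw [hx]
    · intro x hx
      rw [hψ.eq_zero_of_notMem hx, zero_smul]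
  rw [h1, h2, integral_smul_fderiv_eq_neg_fderiv_smul_of_integrable (hint hψ' hφ) (hint hψ hφ')
    (hint hψ hφ) (fun x _ => hψ.smooth.differentiable (by simp) x)
    (fun x _ => hφ.smooth.differentiable (by simp) x), neg_neg]

/-! ### The graph of the gradient -/

/-- The Hilbert space `L²(Ω)² × (L²(Ω)²)²` of pairs of a field and a candidate for its gradient. -/
abbrev Jet (Ω : Set Plane) : Type := WithLp 2 (L2 Ω × PiLp 2 fun _ : Fin 2 => L2 Ω)

/-- The pair `(u, ∇u)`. -/
def jet (Ω : Set Plane) (u : L2 Ω) : Jet Ω := WithLp.toLp 2 (u, WithLp.toLp 2 fun i => pd Ω i u)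

/-- The pairs `(φ, ∇φ)` with `φ ∈ C_c^∞(Ω)²`. -/
def testJets (Ω : Set Plane) : Submodule ℝ (Jet Ω) where
  carrier := {x | IsTestField Ω x.fst ∧ ∀ i, HasWeakPartial Ω i x.fst (x.snd i)}
  zero_mem' := ⟨⟨0, isTest_zero, Lp.coeFn_zero _ _ _⟩, fun i => hasWeakPartial_zero i⟩
  add_mem' := by
    rintro x y ⟨⟨φ, hφ, hx⟩, hx'⟩ ⟨⟨ψ, hψ, hy⟩, hy'⟩
    exact ⟨⟨φ + ψ, hφ.add hψ, (Lp.coeFn_add _ _).trans (hx.add hy)⟩, fun i => (hx' i).add (hy' i)⟩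
  smul_mem' := by
    rintro c x ⟨⟨φ, hφ, hx⟩, hx'⟩
    exact ⟨⟨c • φ, hφ.const_smul c, (Lp.coeFn_smul _ _).trans (hx.const_smul c)⟩,
      fun i => (hx' i).const_smul c⟩

lemma jet_norm_sq (x : Jet Ω) : ‖x‖ ^ 2 = ‖x.fst‖ ^ 2 + ∑ i, ‖x.snd i‖ ^ 2 := by
  rw [WithLp.prod_norm_sq_eq_of_L2, PiLp.norm_sq_eq_of_L2]

lemma HasWeakPartial.of_mem_closure {x : Jet Ω} (hx : x ∈ (testJets Ω).topologicalClosure)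
    (i : Fin 2) : HasWeakPartial Ω i x.fst (x.snd i) := by
  have hcl : IsClosed {x : Jet Ω | HasWeakPartial Ω i x.fst (x.snd i)} :=
    (isClosed_hasWeakPartial i).preimage
      (f := fun x : Jet Ω => (x.fst, x.snd i)) (by fun_prop)
  exact closure_minimal (fun y hy => hy.2 i) hcl hx

/-- `u ∈ H_0^1(Ω)²` if and only if `(u, ∇u)` is a limit of pairs `(φ, ∇φ)` with test fields `φ`. -/
lemma MemH10.jet_mem {u : L2 Ω} (hu : MemH10 Ω u) :
    jet Ω u ∈ (testJets Ω).topologicalClosure := by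
  refine Metric.mem_closure_iff.mpr fun δ hδ => ?_
  obtain ⟨w, ⟨φ, hφ, hw⟩, h1, h2⟩ := hu.2 (δ / 2) (by positivity)
  have hw' : ∀ i, HasWeakPartial Ω i w (pd Ω i w) := MemH1.hasWeakPartial fun i =>
    ⟨_, hφ.hasWeakPartial i hw ((hφ.fderiv_apply _).memLp 2 (vol Ω)).coeFn_toLp⟩
  refine ⟨jet Ω w, ⟨⟨φ, hφ, hw⟩, hw'⟩, ?_⟩
  rw [dist_eq_norm, ← sq_lt_sq₀ (norm_nonneg _) hδ.le, jet_norm_sq, Fin.sum_univ_two]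
  have e1 : ‖(jet Ω u - jet Ω w).fst‖ ^ 2 ≤ (δ / 2) ^ 2 :=
    pow_le_pow_left₀ (norm_nonneg _) h1.le 2
  have e2 : ∀ i, ‖(jet Ω u - jet Ω w).snd i‖ ^ 2 ≤ (δ / 2) ^ 2 := fun i =>
    pow_le_pow_left₀ (norm_nonneg _) (h2 i).le 2
  nlinarith [e2 0, e2 1]

lemma snd_eq_pd (hΩ : IsOpen Ω) {x : Jet Ω} (hx : x ∈ (testJets Ω).topologicalClosure)
    (i : Fin 2) : x.snd i = pd Ω i x.fst :=
  ((HasWeakPartial.of_mem_closure hx i).pd_eq hΩ).symm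

lemma memH10_fst (hΩ : IsOpen Ω) {x : Jet Ω} (hx : x ∈ (testJets Ω).topologicalClosure) :
    MemH10 Ω x.fst := by
  refine ⟨fun i => ⟨_, HasWeakPartial.of_mem_closure hx i⟩, fun δ hδ => ?_⟩
  obtain ⟨y, hy, hxy⟩ := Metric.mem_closure_iff.mp hx δ hδ
  rw [dist_eq_norm] at hxy
  refine ⟨y.fst, hy.1, ?_, fun i => ?_⟩
  · exact (WithLp.norm_fst_le _ (x - y)).trans_lt hxy
  · rw [← snd_eq_pd hΩ hx, ← snd_eq_pd hΩ (Submodule.le_topologicalClosure _ hy)]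
    exact ((PiLp.norm_apply_le (x - y).snd i).trans (WithLp.norm_snd_le _ (x - y))).trans_lt hxy

/-- The map `(u, g) ↦ ∑ i, (g i)_i`, which is the divergence on pairs `(u, ∇u)`. -/
def divL (Ω : Set Plane) : Jet Ω →L[ℝ] Lp ℝ 2 (vol Ω) :=
  ∑ i : Fin 2, ((EuclideanSpace.proj i : Plane →L[ℝ] ℝ).compLpL 2 (vol Ω)).comp
    ((PiLp.proj 2 (fun _ : Fin 2 => L2 Ω) i : _ →L[ℝ] L2 Ω).comp (WithLp.sndL 2 ℝ _ _))

lemma divL_eq_zero_iff (x : Jet Ω) :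
    divL Ω x = 0 ↔ ∀ᵐ y ∂(vol Ω), ∑ i, (x.snd i y) i = 0 := by
  rw [Lp.eq_zero_iff_ae_eq_zero]
  have h : divL Ω x =ᵐ[vol Ω] fun y => ∑ i, (x.snd i y) i := by
    have h0 := ContinuousLinearMap.coeFn_compLp (EuclideanSpace.proj 0 : Plane →L[ℝ] ℝ) (x.snd 0)
    have h1 := ContinuousLinearMap.coeFn_compLp (EuclideanSpace.proj 1 : Plane →L[ℝ] ℝ) (x.snd 1)
    have hs : divL Ω x = (EuclideanSpace.proj 0 : Plane →L[ℝ] ℝ).compLp (x.snd 0)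
        + (EuclideanSpace.proj 1 : Plane →L[ℝ] ℝ).compLp (x.snd 1) := by
      simp [divL, Fin.sum_univ_two]
      rfl
    rw [hs]
    filter_upwards [h0, h1, Lp.coeFn_add ((EuclideanSpace.proj 0 : Plane →L[ℝ] ℝ).compLp (x.snd 0))
      ((EuclideanSpace.proj 1 : Plane →L[ℝ] ℝ).compLp (x.snd 1))] with y e0 e1 e2
    rw [e2, Pi.add_apply, e0, e1, Fin.sum_univ_two]
    rfl
  constructor
  · intro h'
    filter_upwards [h, h'] with y e e'
    rw [← e, e']; rfl
  · intro h'
    filter_upwards [h, h'] with y e e'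
    rw [e, e']; rfl

/-- The closed subspace of pairs `(v, ∇v)` with `v ∈ V`, a copy of `V` with the `H¹` inner
product. -/
def vJets (Ω : Set Plane) : Submodule ℝ (Jet Ω) :=
  (testJets Ω).topologicalClosure ⊓ LinearMap.ker (divL Ω : Jet Ω →ₗ[ℝ] Lp ℝ 2 (vol Ω))

lemma isClosed_vJets : IsClosed (vJets Ω : Set (Jet Ω)) :=
  (Submodule.isClosed_topologicalClosure _).inter (divL Ω).isClosed_ker

instance : CompleteSpace (vJets Ω) := isClosed_vJets.completeSpace_coe

lemma MemV.jet_mem {u : L2 Ω} (hu : MemV Ω u) : jet Ω u ∈ vJets Ω :=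
  ⟨hu.1.jet_mem, (divL_eq_zero_iff _).mpr hu.2⟩

lemma memV_fst (hΩ : IsOpen Ω) {x : Jet Ω} (hx : x ∈ vJets Ω) : MemV Ω x.fst := by
  refine ⟨memH10_fst hΩ hx.1, ?_⟩
  have := (divL_eq_zero_iff x).mp hx.2
  simpa only [snd_eq_pd hΩ hx.1] using this

/-! ### The trilinear form -/

lemma norm_fderiv_le_sum (L : Plane →L[ℝ] Plane) :
    ‖L‖ ≤ ∑ i : Fin 2, ‖L (EuclideanSpace.single i 1)‖ := by
  refine L.opNorm_le_bound (by positivity) fun x => ?_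
  have hx : x = ∑ i : Fin 2, x i • EuclideanSpace.single i (1 : ℝ) := by
    ext j
    fin_cases j <;> simp [Fin.sum_univ_two]
  calc ‖L x‖ = ‖∑ i : Fin 2, x i • L (EuclideanSpace.single i 1)‖ := by
        conv_lhs => rw [hx]
        simp only [map_sum, map_smul]
    _ ≤ ∑ i : Fin 2, ‖x‖ * ‖L (EuclideanSpace.single i 1)‖ := by
        refine norm_sum_le_of_le _ fun i _ => ?_
        rw [norm_smul]
        gcongr
        exact PiLp.norm_apply_le x i
    _ = _ := by rw [← Finset.mul_sum, mul_comm]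

lemma eLpNorm_le_eLpNorm_two_of_support_subset {G : Type*} [NormedAddCommGroup G] {g : Plane → G}
    (hg : Continuous g) (hs : Function.support g ⊆ Ω) :
    eLpNorm g ((4 / 3 : NNReal) : ℝ≥0∞) volume
      ≤ eLpNorm g 2 (vol Ω) * (vol Ω) univ ^ (1 / 4 : ℝ) := by
  rw [← eLpNorm_restrict_eq_of_support_subset hs]
  refine (eLpNorm_le_eLpNorm_mul_rpow_measure_univ (q := 2) ?_
    hg.aestronglyMeasurable).trans_eq ?_
  · rw [← ENNReal.coe_ofNat, ENNReal.coe_le_coe, div_le_iff₀ (by norm_num)]; norm_num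
  · congr 2
    simp only [ENNReal.coe_toReal, ENNReal.toReal_ofNat]
    norm_num

/-- The Sobolev inequality `‖φ‖_{L⁴} ≤ C ‖∇φ‖_{L²}` for test fields: the
Gagliardo–Nirenberg–Sobolev inequality bounds the left side by the norm of the derivative in
`L^{4/3}`, and `Ω` has finite measure. -/
lemma exists_eLpNorm_four_le_of_isTest (hb : Bornology.IsBounded Ω) :
    ∃ C : ℝ≥0∞, C ≠ ⊤ ∧ ∀ φ : Plane → Plane, IsTest Ω φ → eLpNorm φ 4 (vol Ω)
      ≤ C * ∑ i : Fin 2, eLpNorm (fun x => fderiv ℝ φ x (EuclideanSpace.single i 1)) 2 (vol Ω) := by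
  refine ⟨eLpNormLESNormFDerivOfLeConst Plane volume Ω (4 / 3) 4 * (vol Ω) univ ^ (1 / 4 : ℝ),
    ENNReal.mul_ne_top ENNReal.coe_ne_top (ENNReal.rpow_ne_top_of_nonneg (by norm_num) ?_),
    fun φ hφ => ?_⟩
  · rw [Measure.restrict_apply_univ]
    exact hb.measure_lt_top.ne
  have h1 : ContDiff ℝ 1 φ := hφ.smooth.of_le (by simp)
  have hs : Function.support φ ⊆ Ω := (subset_tsupport φ).trans hφ.support
  have hGNS := eLpNorm_le_eLpNorm_fderiv_of_le (μ := (volume : Measure Plane)) (F := Plane)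
    (p := 4 / 3) (q := 4) h1 hs (by rw [le_div_iff₀ (by norm_num)]; norm_num)
    (by rw [finrank_euclideanSpace_fin, div_lt_iff₀ (by norm_num)]; norm_num)
    (by rw [finrank_euclideanSpace_fin]; norm_num) hb
  have hs' : Function.support (fderiv ℝ φ) ⊆ Ω :=
    (subset_tsupport _).trans ((tsupport_fderiv_subset ℝ).trans hφ.support)
  have hcont : Continuous (fderiv ℝ φ) := h1.continuous_fderiv (by simp)
  have hmeas : ∀ i : Fin 2, AEStronglyMeasurable
      (fun x => ‖fderiv ℝ φ x (EuclideanSpace.single i 1)‖) (vol Ω) := fun i =>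
    (hcont.clm_apply continuous_const).norm.aestronglyMeasurable
  have hhold : eLpNorm (fderiv ℝ φ) ((4 / 3 : NNReal) : ℝ≥0∞) volume
      ≤ eLpNorm (fderiv ℝ φ) 2 (vol Ω) * (vol Ω) univ ^ (1 / 4 : ℝ) :=
    eLpNorm_le_eLpNorm_two_of_support_subset hcont hs'
  have hsum : eLpNorm (fderiv ℝ φ) 2 (vol Ω)
      ≤ ∑ i : Fin 2, eLpNorm (fun x => fderiv ℝ φ x (EuclideanSpace.single i 1)) 2 (vol Ω) := by
    calc eLpNorm (fderiv ℝ φ) 2 (vol Ω)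
        ≤ eLpNorm (∑ i : Fin 2, fun x => ‖fderiv ℝ φ x (EuclideanSpace.single i 1)‖) 2 (vol Ω) := by
          refine eLpNorm_mono_real fun x => ?_
          rw [Finset.sum_apply]
          exact norm_fderiv_le_sum _
      _ ≤ ∑ i : Fin 2, eLpNorm (fun x => ‖fderiv ℝ φ x (EuclideanSpace.single i 1)‖) 2 (vol Ω) :=
          eLpNorm_sum_le (fun i _ => hmeas i) (by norm_num)
      _ = _ := by simp only [eLpNorm_norm]
  calc eLpNorm φ 4 (vol Ω) ≤ eLpNorm φ 4 volume := eLpNorm_restrict_le _ _ _ _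
    _ ≤ _ := hGNS
    _ ≤ eLpNormLESNormFDerivOfLeConst Plane volume Ω (4 / 3) 4
        * ((∑ i : Fin 2, eLpNorm (fun x => fderiv ℝ φ x (EuclideanSpace.single i 1)) 2 (vol Ω))
          * (vol Ω) univ ^ (1 / 4 : ℝ)) := by
        gcongr
        exact hhold.trans (by gcongr)
    _ = _ := by ring

lemma snd_ae_eq_fderiv (hΩ : IsOpen Ω) {y : Jet Ω} (hy : y ∈ testJets Ω) {φ : Plane → Plane}
    (hφ : IsTest Ω φ) (hyφ : y.fst =ᵐ[vol Ω] φ) (i : Fin 2) :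
    y.snd i =ᵐ[vol Ω] fun x => fderiv ℝ φ x (EuclideanSpace.single i 1) := by
  have hm := (hφ.fderiv_apply (EuclideanSpace.single i 1)).memLp 2 (vol Ω)
  rw [(hy.2 i).unique hΩ (hφ.hasWeakPartial i hyφ hm.coeFn_toLp)]
  exact hm.coeFn_toLp

/-- The embedding `H_0^1(Ω)² ⊂ L⁴(Ω)²`. It passes from test fields to the closure because the
`L⁴` norm is lower semicontinuous under convergence almost everywhere. -/
lemma exists_eLpNorm_four_le (hΩ : IsOpen Ω) (hb : Bornology.IsBounded Ω) :
    ∃ C : ℝ≥0∞, C ≠ ⊤ ∧ ∀ x ∈ (testJets Ω).topologicalClosure,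
      eLpNorm x.fst 4 (vol Ω) ≤ C * ‖x‖ₑ := by
  obtain ⟨C, hC, hCφ⟩ := exists_eLpNorm_four_le_of_isTest hb
  have htest : ∀ y ∈ testJets Ω, eLpNorm y.fst 4 (vol Ω) ≤ C * 2 * ‖y‖ₑ := by
    intro y hy
    obtain ⟨φ, hφ, hyφ⟩ := hy.1
    rw [eLpNorm_congr_ae hyφ]
    refine (hCφ φ hφ).trans ?_
    rw [mul_assoc]
    gcongr
    have : ∀ i : Fin 2,
        eLpNorm (fun x => fderiv ℝ φ x (EuclideanSpace.single i 1)) 2 (vol Ω) ≤ ‖y‖ₑ := fun i => by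
      rw [← eLpNorm_congr_ae (snd_ae_eq_fderiv hΩ hy hφ hyφ i), ← Lp.enorm_def,
        enorm_le_iff_norm_le]
      exact (PiLp.norm_apply_le y.snd i).trans (WithLp.norm_snd_le _ y)
    rw [Fin.sum_univ_two, two_mul]
    exact add_le_add (this 0) (this 1)
  refine ⟨C * 2, ENNReal.mul_ne_top hC (by norm_num), fun x hx => ?_⟩
  obtain ⟨y, hy, hyx⟩ := mem_closure_iff_seq_limit.mp hx
  have hfst : Filter.Tendsto (fun n => (y n).fst) Filter.atTop (nhds x.fst) :=
    ((WithLp.continuous_fst 2 _ _).tendsto x).comp hyx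
  obtain ⟨ns, hns, hae⟩ := (tendstoInMeasure_of_tendsto_Lp hfst).exists_seq_tendsto_ae
  have hlim : Filter.Tendsto (fun n => C * 2 * ‖y (ns n)‖ₑ) Filter.atTop (nhds (C * 2 * ‖x‖ₑ)) :=
    ENNReal.Tendsto.const_mul ((hyx.comp hns.tendsto_atTop).enorm)
      (Or.inr (ENNReal.mul_ne_top hC (by norm_num)))
  calc eLpNorm x.fst 4 (vol Ω)
      ≤ Filter.atTop.liminf fun n => eLpNorm (y (ns n)).fst 4 (vol Ω) :=
        Lp.eLpNorm_lim_le_liminf_eLpNorm (fun n => Lp.aestronglyMeasurable _) _ hae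
    _ ≤ Filter.atTop.liminf fun n => C * 2 * ‖y (ns n)‖ₑ :=
        Filter.liminf_le_liminf (.of_forall fun n => htest _ (hy _))
    _ = _ := hlim.liminf_eq

/-- The integrand `((u · ∇) v) · w` of the trilinear form, with `g` in place of `∇v`. -/
def advection (u : L2 Ω) (g : PiLp 2 fun _ : Fin 2 => L2 Ω) (w : L2 Ω) (x : Plane) : ℝ :=
  inner ℝ (∑ i, (u x i) • g i x) (w x)

lemma aestronglyMeasurable_advection (u : L2 Ω) (g : PiLp 2 fun _ : Fin 2 => L2 Ω) (w : L2 Ω) :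
    AEStronglyMeasurable (advection u g w) (vol Ω) := by
  refine AEStronglyMeasurable.inner ?_ (Lp.aestronglyMeasurable w)
  refine Finset.aestronglyMeasurable_fun_sum _ fun i _ => ?_
  exact ((EuclideanSpace.proj i : Plane →L[ℝ] ℝ).continuous.comp_aestronglyMeasurable
    (Lp.aestronglyMeasurable u)).smul (Lp.aestronglyMeasurable (g i))

instance : ENNReal.HolderTriple 4 4 2 where
  inv_add_inv_eq_inv := by
    rw [← two_mul, show (4 : ℝ≥0∞) = 2 * 2 by norm_num,
      ENNReal.mul_inv (by norm_num) (by norm_num), ← mul_assoc,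
      ENNReal.mul_inv_cancel (by norm_num) (by norm_num), one_mul]

/-- Hölder's inequality with exponents `4`, `2`, `4` for the trilinear form. -/
lemma eLpNorm_advection_le (u : L2 Ω) (g : PiLp 2 fun _ : Fin 2 => L2 Ω) (w : L2 Ω) :
    eLpNorm (advection u g w) 1 (vol Ω)
      ≤ 2 * (eLpNorm u 4 (vol Ω) * ‖g‖ₑ * eLpNorm w 4 (vol Ω)) := by
  have hu := Lp.aestronglyMeasurable u
  have hw := Lp.aestronglyMeasurable w
  have huw : ∀ i : Fin 2, AEStronglyMeasurable (fun x => u x i • w x) (vol Ω) := fun i =>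
    ((EuclideanSpace.proj i : Plane →L[ℝ] ℝ).continuous.comp_aestronglyMeasurable hu).smul hw
  have hi : ∀ i : Fin 2, eLpNorm (fun x => inner ℝ (g i x) (u x i • w x)) 1 (vol Ω)
      ≤ eLpNorm u 4 (vol Ω) * ‖g‖ₑ * eLpNorm w 4 (vol Ω) := by
    intro i
    have h1 : eLpNorm (fun x => u x i • w x) 2 (vol Ω)
        ≤ (1 : NNReal) * eLpNorm u 4 (vol Ω) * eLpNorm w 4 (vol Ω) :=
      eLpNorm_le_eLpNorm_mul_eLpNorm'_of_norm hu hw (fun a b => a i • b) 1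
        (.of_forall fun x => by
          rw [norm_smul, NNReal.coe_one, one_mul]
          gcongr
          exact PiLp.norm_apply_le (u x) i)
    have h2 : eLpNorm (fun x => inner ℝ (g i x) (u x i • w x)) 1 (vol Ω)
        ≤ (1 : NNReal) * eLpNorm (g i) 2 (vol Ω) * eLpNorm (fun x => u x i • w x) 2 (vol Ω) :=
      eLpNorm_le_eLpNorm_mul_eLpNorm'_of_norm (Lp.aestronglyMeasurable (g i)) (huw i)
        (fun a b => inner ℝ a b) 1
        (.of_forall fun x => by
          rw [NNReal.coe_one, one_mul]
          exact norm_inner_le_norm _ _)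
    have h3 : eLpNorm (g i) 2 (vol Ω) ≤ ‖g‖ₑ := by
      rw [← Lp.enorm_def, enorm_le_iff_norm_le]
      exact PiLp.norm_apply_le g i
    rw [ENNReal.coe_one, one_mul] at h1 h2
    calc _ ≤ _ := h2
      _ ≤ ‖g‖ₑ * (eLpNorm u 4 (vol Ω) * eLpNorm w 4 (vol Ω)) := by gcongr
      _ = _ := by ring
  have heq : advection u g w = ∑ i : Fin 2, fun x => inner ℝ (g i x) (u x i • w x) := by
    funext x
    simp only [advection, Finset.sum_apply, sum_inner, real_inner_smul_left, real_inner_smul_right]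
  rw [heq]
  refine (eLpNorm_sum_le (fun i _ => (Lp.aestronglyMeasurable (g i)).inner (huw i))
    le_rfl).trans ?_
  rw [Fin.sum_univ_two, two_mul]
  exact add_le_add (hi 0) (hi 1)

lemma integrable_advection {u w : L2 Ω} (g : PiLp 2 fun _ : Fin 2 => L2 Ω)
    (hu : eLpNorm u 4 (vol Ω) ≠ ⊤) (hw : eLpNorm w 4 (vol Ω) ≠ ⊤) :
    Integrable (advection u g w) (vol Ω) := by
  rw [← memLp_one_iff_integrable]
  refine ⟨aestronglyMeasurable_advection u g w, (eLpNorm_advection_le u g w).trans_lt ?_⟩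
  exact ENNReal.mul_lt_top (by norm_num)
    (ENNReal.mul_lt_top (ENNReal.mul_lt_top hu.lt_top enorm_lt_top) hw.lt_top)

lemma enorm_integral_advection_le (u : L2 Ω) (g : PiLp 2 fun _ : Fin 2 => L2 Ω) (w : L2 Ω) :
    ‖∫ x in Ω, advection u g w x‖ₑ
      ≤ 2 * (eLpNorm u 4 (vol Ω) * ‖g‖ₑ * eLpNorm w 4 (vol Ω)) :=
  (enorm_integral_le_lintegral_enorm _).trans
    (by rw [← eLpNorm_one_eq_lintegral_enorm]; exact eLpNorm_advection_le u g w)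

/-- For a divergence-free `u` and a test field `φ`, the field `(u · ∇) φ` is orthogonal to `φ`:
the integrand is `u · ∇(|φ|²/2)`, and `|φ|²/2` is a test function. -/
lemma integral_advection_test (hΩ : IsOpen Ω) {x y : Jet Ω} (hx : x ∈ vJets Ω)
    (hy : y ∈ testJets Ω) : ∫ z in Ω, advection x.fst y.snd y.fst z = 0 := by
  obtain ⟨φ, hφ, hyφ⟩ := hy.1
  have hd := snd_ae_eq_fderiv hΩ hy hφ hyφ
  let ψ : Plane → ℝ := fun z => inner ℝ (φ z) (φ z) / 2
  have hdiff : Differentiable ℝ φ := hφ.smooth.differentiable (by simp)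
  have hψ : IsTest Ω ψ := by
    have hsupp : Function.support ψ ⊆ Function.support φ := fun z hz hz' => hz (by simp [ψ, hz'])
    exact ⟨(hφ.smooth.inner ℝ hφ.smooth).div_const 2, hφ.compact.mono hsupp,
      (closure_mono hsupp).trans hφ.support⟩
  have hψd : ∀ z v, fderiv ℝ ψ z v = inner ℝ (fderiv ℝ φ z v) (φ z) := by
    intro z v
    have : HasFDerivAt ψ ((1 / 2 : ℝ) • ((fderivInnerCLM ℝ (φ z, φ z)).comp
        ((fderiv ℝ φ z).prod (fderiv ℝ φ z)))) z := by
      have h := (((hdiff z).hasFDerivAt.inner ℝ (hdiff z).hasFDerivAt)).const_mul (1 / 2 : ℝ)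
      refine h.congr_of_eventuallyEq (.of_forall fun t => ?_)
      simp only [ψ]; ring
    rw [this.fderiv]
    simp [fderivInnerCLM_apply, real_inner_comm (φ z)]
    ring
  have hψ2 := hψ.memLp 2 (vol Ω)
  have hψd2 := fun i : Fin 2 => (hψ.fderiv_apply (EuclideanSpace.single i 1)).memLp 2 (vol Ω)
  have hint : ∀ {a : Plane → ℝ} (_ : MemLp a 2 (vol Ω)) (v : L2 Ω),
      Integrable (fun z => a z • v z) (vol Ω) := fun ha v =>
    memLp_one_iff_integrable.mp ((Lp.memLp v).smul ha)
  have hcoord : ∀ {a : Plane → ℝ} (_ : MemLp a 2 (vol Ω)) (v : L2 Ω) (i : Fin 2),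
      ∫ z in Ω, a z * v z i = (∫ z in Ω, a z • v z) i := fun ha v i =>
    (EuclideanSpace.proj i : Plane →L[ℝ] ℝ).integral_comp_comm (hint ha v)
  have hcoordi : ∀ {a : Plane → ℝ} (_ : MemLp a 2 (vol Ω)) (v : L2 Ω) (i : Fin 2),
      Integrable (fun z => a z * v z i) (vol Ω) := fun ha v i =>
    (EuclideanSpace.proj i : Plane →L[ℝ] ℝ).integrable_comp (hint ha v)
  have hstep : ∀ i : Fin 2, ∫ z in Ω, fderiv ℝ ψ z (EuclideanSpace.single i 1) * x.fst z i
      = -∫ z in Ω, ψ z * x.snd i z i := by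
    intro i
    rw [hcoord (hψd2 i), hcoord hψ2, HasWeakPartial.of_mem_closure hx.1 i ψ hψ]
    rfl
  calc ∫ z in Ω, advection x.fst y.snd y.fst z
      = ∫ z in Ω, ∑ i : Fin 2, fderiv ℝ ψ z (EuclideanSpace.single i 1) * x.fst z i := by
        refine integral_congr_ae ?_
        filter_upwards [hyφ, hd 0, hd 1] with z h1 h2 h3
        simp only [advection, Fin.sum_univ_two, h1, h2, h3, inner_add_left, real_inner_smul_left,
          hψd]
        ring
    _ = -∫ z in Ω, ∑ i : Fin 2, ψ z * x.snd i z i := by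
        rw [integral_finsetSum _ fun i _ => hcoordi (hψd2 i) _ i,
          integral_finsetSum _ fun i _ => hcoordi hψ2 _ i, ← Finset.sum_neg_distrib]
        exact Finset.sum_congr rfl fun i _ => hstep i
    _ = -∫ z in Ω, (0 : ℝ) := by
        congr 1
        refine integral_congr_ae ?_
        filter_upwards [(divL_eq_zero_iff x).mp hx.2] with z hz
        rw [← Finset.mul_sum, hz, mul_zero]
    _ = 0 := by simp

/-- `b(v, v, v) = 0` for `v ∈ V`. The form is continuous on `H_0^1(Ω)²` by Hölder's inequality and
the embedding into `L⁴`, so that the last two arguments may be approximated by test fields. -/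
theorem trilinear_self_eq_zero (hΩ : IsOpen Ω) (hb : Bornology.IsBounded Ω) {v : L2 Ω}
    (hv : MemV Ω v) : trilinear Ω v v v = 0 := by
  obtain ⟨C, hC, hC4⟩ := exists_eLpNorm_four_le hΩ hb
  have hx := hv.jet_mem
  set x := jet Ω v
  have htri : trilinear Ω v v v = ∫ z in Ω, advection x.fst x.snd x.fst z := rfl
  rw [htri]
  obtain ⟨y, hy, hyx⟩ := mem_closure_iff_seq_limit.mp hx.1
  have hyc : ∀ n, y n ∈ (testJets Ω).topologicalClosure := fun n =>
    Submodule.le_topologicalClosure _ (hy n)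
  have hfin : ∀ z ∈ (testJets Ω).topologicalClosure, eLpNorm z.fst 4 (vol Ω) ≠ ⊤ := fun z hz =>
    ((hC4 z hz).trans_lt (ENNReal.mul_lt_top hC.lt_top enorm_lt_top)).ne
  have hxf := hfin x hx.1
  have hsplit : ∀ n, ∫ z in Ω, advection x.fst x.snd x.fst z
      = (∫ z in Ω, advection x.fst x.snd (x - y n).fst z)
        + ∫ z in Ω, advection x.fst (x - y n).snd (y n).fst z := by
    intro n
    have hxy := hfin _ (Submodule.sub_mem _ hx.1 (hyc n))
    have hyf := hfin _ (hyc n)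
    have i1 := integrable_advection x.snd hxf hxy
    have i2 := integrable_advection (x - y n).snd hxf hyf
    have i3 := integrable_advection (y n).snd hxf hyf
    rw [← add_zero (_ + _), ← integral_advection_test hΩ hx (hy n), ← integral_add' i1 i2,
      ← integral_add' (i1.add i2) i3]
    refine integral_congr_ae ?_
    filter_upwards [Lp.coeFn_sub x.fst (y n).fst, Lp.coeFn_sub (x.snd 0) ((y n).snd 0),
      Lp.coeFn_sub (x.snd 1) ((y n).snd 1)] with z h1 h2 h3
    rw [← WithLp.sub_fst] at h1
    change (x - y n).snd 0 z = _ at h2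
    change (x - y n).snd 1 z = _ at h3
    simp only [Pi.add_apply, advection, Fin.sum_univ_two, h1, h2, h3, Pi.sub_apply, inner_sub_right,
      inner_add_left, real_inner_smul_left, inner_sub_left, smul_sub]
    ring
  have hbound : ∀ n, ‖∫ z in Ω, advection x.fst x.snd x.fst z‖ₑ
      ≤ 2 * (eLpNorm x.fst 4 (vol Ω) * ‖x‖ₑ * (C * ‖x - y n‖ₑ))
        + 2 * (eLpNorm x.fst 4 (vol Ω) * ‖x - y n‖ₑ * (C * ‖y n‖ₑ)) := by
    intro n
    rw [hsplit n]
    refine (enorm_add_le _ _).trans (add_le_add ?_ ?_)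
    · refine (enorm_integral_advection_le _ _ _).trans ?_
      gcongr
      · exact enorm_le_iff_norm_le.mpr (WithLp.norm_snd_le _ x)
      · exact hC4 _ (Submodule.sub_mem _ hx.1 (hyc n))
    · refine (enorm_integral_advection_le _ _ _).trans ?_
      gcongr
      · exact enorm_le_iff_norm_le.mpr (WithLp.norm_snd_le _ (x - y n))
      · exact hC4 _ (hyc n)
  have hd : Filter.Tendsto (fun n => ‖x - y n‖ₑ) Filter.atTop (nhds 0) := by
    simpa using (tendsto_const_nhds.sub hyx : Filter.Tendsto (fun n => x - y n) _ _).enorm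
  have hM : eLpNorm x.fst 4 (vol Ω) * ‖x‖ₑ ≠ ⊤ := ENNReal.mul_ne_top hxf enorm_ne_top
  have hlim : Filter.Tendsto (fun n =>
      2 * (eLpNorm x.fst 4 (vol Ω) * ‖x‖ₑ * (C * ‖x - y n‖ₑ))
        + 2 * (eLpNorm x.fst 4 (vol Ω) * ‖x - y n‖ₑ * (C * ‖y n‖ₑ))) Filter.atTop
      (nhds (2 * (eLpNorm x.fst 4 (vol Ω) * ‖x‖ₑ * (C * 0))
        + 2 * (eLpNorm x.fst 4 (vol Ω) * 0 * (C * ‖x‖ₑ)))) := by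
    refine Filter.Tendsto.add ?_ ?_
    · exact ENNReal.Tendsto.const_mul (ENNReal.Tendsto.const_mul
        (ENNReal.Tendsto.const_mul hd (Or.inr hC)) (Or.inr hM)) (Or.inr (by norm_num))
    · exact ENNReal.Tendsto.const_mul (ENNReal.Tendsto.mul
        (ENNReal.Tendsto.const_mul hd (Or.inr hxf)) (Or.inr (ENNReal.mul_ne_top hC enorm_ne_top))
        (ENNReal.Tendsto.const_mul hyx.enorm (Or.inr hC)) (Or.inr (by simp)))
        (Or.inr (by norm_num))
  have h0 := ge_of_tendsto' hlim hbound
  simpa using h0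

/-! ### Compactness of the embedding of `H_0^1` into `L²` -/

lemma add_sq_le_two_mul (a b : ℝ≥0∞) : (a + b) ^ 2 ≤ 2 * (a ^ 2 + b ^ 2) := by
  have h := ENNReal.rpow_add_le_mul_rpow_add_rpow a b one_le_two
  norm_num at h
  exact h

lemma sq_lintegral_le {α : Type*} [MeasurableSpace α] (μ : Measure α) {f : α → ℝ≥0∞}
    (hf : AEMeasurable f μ) : (∫⁻ x, f x ∂μ) ^ 2 ≤ μ univ * ∫⁻ x, f x ^ 2 ∂μ := by
  have h := ENNReal.lintegral_mul_le_Lp_mul_Lq μ Real.HolderConjugate.two_two hf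
    (aemeasurable_const (b := (1 : ℝ≥0∞)))
  simp only [Pi.mul_apply, mul_one, ENNReal.rpow_ofNat, one_pow, lintegral_one] at h
  calc (∫⁻ x, f x ∂μ) ^ 2
      ≤ ((∫⁻ x, f x ^ 2 ∂μ) ^ (1 / 2 : ℝ) * μ univ ^ (1 / 2 : ℝ)) ^ 2 := by gcongr
    _ = μ univ * ∫⁻ x, f x ^ 2 ∂μ := by
        rw [mul_pow, ← ENNReal.rpow_natCast, ← ENNReal.rpow_natCast, ← ENNReal.rpow_mul,
          ← ENNReal.rpow_mul]
        norm_num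
        rw [mul_comm]

lemma enorm_sq_eq_lintegral {α E : Type*} [MeasurableSpace α] {μ : Measure α}
    [NormedAddCommGroup E] (w : Lp E 2 μ) : ‖w‖ₑ ^ 2 = ∫⁻ x, ‖w x‖ₑ ^ 2 ∂μ := by
  have h := eLpNorm_nnreal_pow_eq_lintegral (f := w) (μ := μ) (p := 2) two_ne_zero
  rw [Lp.enorm_def]
  simpa using h

/-- Translations are Lipschitz in `L²` on functions with a square integrable gradient. -/
lemma lintegral_translate_sub_sq_le {φ : Plane → Plane} (hφ : ContDiff ℝ 1 φ) (h : Plane) :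
    ∫⁻ x, ‖φ (x + h) - φ x‖ₑ ^ 2 ≤ ‖h‖ₑ ^ 2 * ∫⁻ x, ‖fderiv ℝ φ x‖ₑ ^ 2 := by
  have hD : Continuous (fderiv ℝ φ) := hφ.continuous_fderiv one_ne_zero
  have hcont : ∀ x, Continuous fun t : ℝ => fderiv ℝ φ (x + t • h) h := fun x =>
    (hD.comp (by fun_prop)).clm_apply continuous_const
  have hpt : ∀ x, ‖φ (x + h) - φ x‖ₑ ^ 2
      ≤ ∫⁻ t in Ioc (0 : ℝ) 1, ‖h‖ₑ ^ 2 * ‖fderiv ℝ φ (x + t • h)‖ₑ ^ 2 := by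
    intro x
    have hFTC : ∫ t in (0 : ℝ)..1, fderiv ℝ φ (x + t • h) h = φ (x + h) - φ x := by
      have hder : ∀ t ∈ uIcc (0 : ℝ) 1,
          HasDerivAt (fun t : ℝ => φ (x + t • h)) (fderiv ℝ φ (x + t • h) h) t := by
        intro t _
        have h1 : HasDerivAt (fun t : ℝ => x + t • h) h t := by
          simpa using ((hasDerivAt_id t).smul_const h).const_add x
        exact ((hφ.differentiable one_ne_zero _).hasFDerivAt).comp_hasDerivAt t h1
      rw [intervalIntegral.integral_eq_sub_of_hasDerivAt hder
        ((hcont x).intervalIntegrable 0 1)]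
      simp
    rw [← hFTC, intervalIntegral.integral_of_le zero_le_one]
    calc ‖∫ t in Ioc (0 : ℝ) 1, fderiv ℝ φ (x + t • h) h‖ₑ ^ 2
        ≤ (∫⁻ t in Ioc (0 : ℝ) 1, ‖fderiv ℝ φ (x + t • h) h‖ₑ) ^ 2 := by
          gcongr
          exact enorm_integral_le_lintegral_enorm _
      _ ≤ (volume.restrict (Ioc (0 : ℝ) 1)) univ
            * ∫⁻ t in Ioc (0 : ℝ) 1, ‖fderiv ℝ φ (x + t • h) h‖ₑ ^ 2 :=
          sq_lintegral_le _ (hcont x).enorm.aemeasurable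
      _ = ∫⁻ t in Ioc (0 : ℝ) 1, ‖fderiv ℝ φ (x + t • h) h‖ₑ ^ 2 := by simp
      _ ≤ _ := by
          refine lintegral_mono fun t => ?_
          rw [← mul_pow]
          gcongr
          rw [mul_comm]
          exact (fderiv ℝ φ (x + t • h)).le_opENorm h
  have hmeas : Measurable (Function.uncurry fun (x : Plane) (t : ℝ) =>
      ‖h‖ₑ ^ 2 * ‖fderiv ℝ φ (x + t • h)‖ₑ ^ 2) := by
    have : Continuous fun p : Plane × ℝ => fderiv ℝ φ (p.1 + p.2 • h) :=
      hD.comp (by fun_prop)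
    exact (this.enorm.measurable.pow_const 2).const_mul _
  calc ∫⁻ x, ‖φ (x + h) - φ x‖ₑ ^ 2
      ≤ ∫⁻ x, ∫⁻ t in Ioc (0 : ℝ) 1, ‖h‖ₑ ^ 2 * ‖fderiv ℝ φ (x + t • h)‖ₑ ^ 2 :=
        lintegral_mono hpt
    _ = ∫⁻ t in Ioc (0 : ℝ) 1, ∫⁻ x, ‖h‖ₑ ^ 2 * ‖fderiv ℝ φ (x + t • h)‖ₑ ^ 2 :=
        lintegral_lintegral_swap hmeas.aemeasurable
    _ = ∫⁻ t in Ioc (0 : ℝ) 1, ‖h‖ₑ ^ 2 * ∫⁻ x, ‖fderiv ℝ φ x‖ₑ ^ 2 := by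
        refine lintegral_congr fun t => ?_
        rw [lintegral_add_right_eq_self (fun x => ‖h‖ₑ ^ 2 * ‖fderiv ℝ φ x‖ₑ ^ 2),
          lintegral_const_mul _ (hD.enorm.measurable.pow_const 2)]
    _ = _ := by simp

/-- Near the centre `z` of a ball, a function is controlled by its integral over the ball and its
oscillation at distance `2 s`. -/
lemma measure_sq_mul_enorm_sq_le {φ : Plane → Plane} (hφ : Continuous φ) {s : ℝ} {x z : Plane}
    (hxz : x ∈ Metric.ball z s) :
    volume (Metric.ball z s) ^ 2 * ‖φ x‖ₑ ^ 2
      ≤ 2 * (volume (Metric.ball z s)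
          * ∫⁻ h in Metric.ball (0 : Plane) (2 * s), ‖φ (x + h) - φ x‖ₑ ^ 2)
        + 2 * ‖∫ y in Metric.ball z s, φ y‖ₑ ^ 2 := by
  have hfin : volume (Metric.ball z s) ≠ ⊤ := measure_ball_lt_top.ne
  have hint : IntegrableOn φ (Metric.ball z s) :=
    (hφ.continuousOn.integrableOn_compact (isCompact_closedBall z s)).mono_set
      Metric.ball_subset_closedBall
  have hc : IntegrableOn (fun _ => φ x) (Metric.ball z s) := integrableOn_const hfin
  have hsplit : volume.real (Metric.ball z s) • φ x
      = (∫ y in Metric.ball z s, (φ x - φ y)) + ∫ y in Metric.ball z s, φ y := by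
    rw [integral_sub hc hint, sub_add_cancel, setIntegral_const]
  have hV : ‖volume.real (Metric.ball z s)‖ₑ = volume (Metric.ball z s) := by
    rw [Real.enorm_eq_ofReal measureReal_nonneg, ofReal_measureReal hfin]
  have hosc : ‖∫ y in Metric.ball z s, (φ x - φ y)‖ₑ ^ 2
      ≤ volume (Metric.ball z s)
        * ∫⁻ h in Metric.ball (0 : Plane) (2 * s), ‖φ (x + h) - φ x‖ₑ ^ 2 := by
    calc ‖∫ y in Metric.ball z s, (φ x - φ y)‖ₑ ^ 2
        ≤ (∫⁻ y in Metric.ball z s, ‖φ x - φ y‖ₑ) ^ 2 := by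
          gcongr
          exact enorm_integral_le_lintegral_enorm _
      _ ≤ volume (Metric.ball z s) * ∫⁻ y in Metric.ball z s, ‖φ x - φ y‖ₑ ^ 2 := by
          have := sq_lintegral_le (volume.restrict (Metric.ball z s))
            (f := fun y => ‖φ x - φ y‖ₑ) (by fun_prop)
          rwa [Measure.restrict_apply_univ] at this
      _ ≤ _ := by
          gcongr 1
          rw [← lintegral_indicator measurableSet_ball, ← lintegral_indicator measurableSet_ball,
            ← lintegral_add_left_eq_self _ x]
          refine lintegral_mono fun h => ?_
          by_cases hh : x + h ∈ Metric.ball z s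
          · have hh0 : h ∈ Metric.ball (0 : Plane) (2 * s) := by
              rw [mem_ball_zero_iff]
              rw [Metric.mem_ball, dist_eq_norm] at hh hxz
              calc ‖h‖ = ‖(x + h - z) - (x - z)‖ := by congr 1; abel
                _ ≤ ‖x + h - z‖ + ‖x - z‖ := norm_sub_le _ _
                _ < 2 * s := by linarith
            rw [indicator_of_mem hh, indicator_of_mem hh0, enorm_sub_rev]
          · rw [indicator_of_notMem hh]
            exact zero_le
  calc volume (Metric.ball z s) ^ 2 * ‖φ x‖ₑ ^ 2
      = ‖(∫ y in Metric.ball z s, (φ x - φ y)) + ∫ y in Metric.ball z s, φ y‖ₑ ^ 2 := by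
        rw [← hsplit, enorm_smul, hV, mul_pow]
    _ ≤ (‖∫ y in Metric.ball z s, (φ x - φ y)‖ₑ + ‖∫ y in Metric.ball z s, φ y‖ₑ) ^ 2 := by
        gcongr
        exact enorm_add_le _ _
    _ ≤ 2 * (‖∫ y in Metric.ball z s, (φ x - φ y)‖ₑ ^ 2 + ‖∫ y in Metric.ball z s, φ y‖ₑ ^ 2) :=
        add_sq_le_two_mul _ _
    _ ≤ _ := by
        rw [mul_add]
        gcongr

/-- If finitely many balls of radius `s` cover `Ω`, then the `L²(Ω)` norm of `φ` is controlled by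
the integrals of `φ` over these balls up to a small multiple of the norm of its gradient. -/
lemma lintegral_enorm_sq_le_of_cover {φ : Plane → Plane} (hφ : ContDiff ℝ 1 φ) {s : ℝ}
    (hs : 0 < s) (t : Finset Plane) (ht : Ω ⊆ ⋃ z ∈ t, Metric.ball z s) (hΩ : MeasurableSet Ω) :
    volume (Metric.ball (0 : Plane) s) ^ 2 * ∫⁻ x in Ω, ‖φ x‖ₑ ^ 2
      ≤ volume (Metric.ball (0 : Plane) s) ^ 2
          * (ENNReal.ofReal (32 * s ^ 2) * ∫⁻ x, ‖fderiv ℝ φ x‖ₑ ^ 2)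
        + 2 * volume Ω * ∑ z ∈ t, ‖∫ y in Metric.ball z s, φ y‖ₑ ^ 2 := by
  set V := volume (Metric.ball (0 : Plane) s) with hV
  have hVz : ∀ z : Plane, volume (Metric.ball z s) = V := fun z =>
    Measure.addHaar_ball_center _ z s
  have hV2 : volume (Metric.ball (0 : Plane) (2 * s)) = 4 * V := by
    rw [Measure.addHaar_ball_mul _ _ (by norm_num), finrank_euclideanSpace_fin]
    congr 1
    norm_num
  have hφc := hφ.continuous
  have hosc : Measurable (Function.uncurry fun x h : Plane => ‖φ (x + h) - φ x‖ₑ ^ 2) := by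
    have : Continuous fun p : Plane × Plane => φ (p.1 + p.2) - φ p.1 := by fun_prop
    exact this.enorm.measurable.pow_const 2
  have hpt : ∀ x ∈ Ω, V ^ 2 * ‖φ x‖ₑ ^ 2
      ≤ 2 * (V * ∫⁻ h in Metric.ball (0 : Plane) (2 * s), ‖φ (x + h) - φ x‖ₑ ^ 2)
        + 2 * ∑ z ∈ t, ‖∫ y in Metric.ball z s, φ y‖ₑ ^ 2 := by
    intro x hx
    obtain ⟨z, hz, hxz⟩ := mem_iUnion₂.mp (ht hx)
    have := measure_sq_mul_enorm_sq_le hφc hxz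
    rw [hVz] at this
    refine this.trans ?_
    gcongr
    exact Finset.single_le_sum (f := fun z => ‖∫ y in Metric.ball z s, φ y‖ₑ ^ 2)
      (fun _ _ => zero_le) hz
  have hdouble : ∫⁻ x in Ω, ∫⁻ h in Metric.ball (0 : Plane) (2 * s), ‖φ (x + h) - φ x‖ₑ ^ 2
      ≤ 4 * V * (ENNReal.ofReal ((2 * s) ^ 2) * ∫⁻ x, ‖fderiv ℝ φ x‖ₑ ^ 2) := by
    calc ∫⁻ x in Ω, ∫⁻ h in Metric.ball (0 : Plane) (2 * s), ‖φ (x + h) - φ x‖ₑ ^ 2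
        ≤ ∫⁻ x, ∫⁻ h in Metric.ball (0 : Plane) (2 * s), ‖φ (x + h) - φ x‖ₑ ^ 2 :=
          setLIntegral_le_lintegral _ _
      _ = ∫⁻ h in Metric.ball (0 : Plane) (2 * s), ∫⁻ x, ‖φ (x + h) - φ x‖ₑ ^ 2 :=
          lintegral_lintegral_swap hosc.aemeasurable
      _ ≤ ∫⁻ h in Metric.ball (0 : Plane) (2 * s),
            ENNReal.ofReal ((2 * s) ^ 2) * ∫⁻ x, ‖fderiv ℝ φ x‖ₑ ^ 2 := by
          refine setLIntegral_mono' measurableSet_ball fun h hh => ?_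
          refine (lintegral_translate_sub_sq_le hφ h).trans ?_
          gcongr
          rw [mem_ball_zero_iff] at hh
          rw [ENNReal.ofReal_pow (by positivity), ← ofReal_norm]
          gcongr
      _ = _ := by rw [setLIntegral_const, hV2, mul_comm]
  calc V ^ 2 * ∫⁻ x in Ω, ‖φ x‖ₑ ^ 2 = ∫⁻ x in Ω, V ^ 2 * ‖φ x‖ₑ ^ 2 :=
        (lintegral_const_mul _ (hφc.enorm.measurable.pow_const 2)).symm
    _ ≤ ∫⁻ x in Ω, (2 * V * (∫⁻ h in Metric.ball (0 : Plane) (2 * s), ‖φ (x + h) - φ x‖ₑ ^ 2)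
        + 2 * ∑ z ∈ t, ‖∫ y in Metric.ball z s, φ y‖ₑ ^ 2) := by
        refine setLIntegral_mono' hΩ fun x hx => ?_
        rw [mul_assoc]
        exact hpt x hx
    _ = 2 * V * (∫⁻ x in Ω, ∫⁻ h in Metric.ball (0 : Plane) (2 * s), ‖φ (x + h) - φ x‖ₑ ^ 2)
        + 2 * (∑ z ∈ t, ‖∫ y in Metric.ball z s, φ y‖ₑ ^ 2) * volume Ω := by
        rw [lintegral_add_right _ measurable_const, setLIntegral_const, lintegral_const_mul]
        exact hosc.lintegral_prod_right'
    _ ≤ 2 * V * (4 * V * (ENNReal.ofReal ((2 * s) ^ 2) * ∫⁻ x, ‖fderiv ℝ φ x‖ₑ ^ 2))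
        + 2 * (∑ z ∈ t, ‖∫ y in Metric.ball z s, φ y‖ₑ ^ 2) * volume Ω := by gcongr
    _ = _ := by
        have : ENNReal.ofReal (32 * s ^ 2) = 8 * ENNReal.ofReal ((2 * s) ^ 2) := by
          rw [show 32 * s ^ 2 = 8 * (2 * s) ^ 2 by ring, ENNReal.ofReal_mul (by norm_num)]
          norm_num
        rw [this]
        ring

/-- Up to an arbitrarily small multiple of its `H¹` norm, the `L²` norm of an element of `H_0^1` is
controlled by finitely many of its averages. -/
lemma exists_norm_sq_le (hΩ : IsOpen Ω) (hb : Bornology.IsBounded Ω) {ε : ℝ} (hε : 0 < ε) :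
    ∃ (t : Finset Plane) (Λ : Plane → L2 Ω →L[ℝ] Plane) (K : ℝ), 0 ≤ K ∧
      ∀ x ∈ (testJets Ω).topologicalClosure,
        ‖x.fst‖ ^ 2 ≤ ε * ‖x‖ ^ 2 + K * ∑ z ∈ t, ‖Λ z x.fst‖ ^ 2 := by
  obtain ⟨s, hs, hsε⟩ : ∃ s : ℝ, 0 < s ∧ 64 * s ^ 2 = ε :=
    ⟨√(ε / 64), by positivity, by rw [Real.sq_sqrt (by positivity)]; ring⟩
  obtain ⟨t', -, ht', hcov⟩ := hb.isCompact_closure.finite_cover_balls hs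
  lift t' to Finset Plane using ht'
  have hind : ∀ z : Plane, MemLp ((Metric.ball z s).indicator fun _ => (1 : ℝ)) 2 (vol Ω) :=
    fun z => memLp_indicator_const 2 measurableSet_ball 1
      (Or.inr ((Measure.restrict_apply_le _ _).trans_lt measure_ball_lt_top).ne)
  let Λ : Plane → L2 Ω →L[ℝ] Plane := fun z => integralSMul ((hind z).toLp _)
  set V := volume.real (Metric.ball (0 : Plane) s) with hVdef
  have hV : 0 < V := ENNReal.toReal_pos (Metric.measure_ball_pos _ _ hs).ne' measure_ball_lt_top.ne
  refine ⟨t', Λ, 2 * volume.real Ω / V ^ 2, by positivity, fun x hx => ?_⟩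
  have hclosed : IsClosed {x : Jet Ω | ‖x.fst‖ ^ 2
      ≤ ε * ‖x‖ ^ 2 + 2 * volume.real Ω / V ^ 2 * ∑ z ∈ t', ‖Λ z x.fst‖ ^ 2} :=
    isClosed_le (by fun_prop) (by fun_prop)
  refine closure_minimal (fun y hy => ?_) hclosed hx
  obtain ⟨φ, hφ, hyφ⟩ := hy.1
  have hφ1 : ContDiff ℝ 1 φ := hφ.smooth.of_le (by simp)
  have hΛ : ∀ z, Λ z y.fst = ∫ x in Metric.ball z s, φ x := by
    intro z
    rw [integralSMul_toLp]
    calc ∫ x in Ω, (Metric.ball z s).indicator (fun _ => (1 : ℝ)) x • y.fst x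
        = ∫ x in Ω, (Metric.ball z s).indicator φ x := by
          refine integral_congr_ae ?_
          filter_upwards [hyφ] with x hx
          by_cases h : x ∈ Metric.ball z s <;> simp [h, hx]
      _ = ∫ x, (Metric.ball z s).indicator φ x := by
          refine setIntegral_eq_integral_of_forall_compl_eq_zero fun x hx => ?_
          by_cases h : x ∈ Metric.ball z s <;> simp [h, hφ.eq_zero_of_notMem hx]
      _ = _ := integral_indicator measurableSet_ball
  have hfst : ∫⁻ x in Ω, ‖φ x‖ₑ ^ 2 = ‖y.fst‖ₑ ^ 2 := by
    rw [enorm_sq_eq_lintegral]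
    refine lintegral_congr_ae ?_
    filter_upwards [hyφ] with x hx
    rw [hx]
  have hgrad : ∫⁻ x, ‖fderiv ℝ φ x‖ₑ ^ 2 ≤ 2 * ‖y‖ₑ ^ 2 := by
    have hpt : ∀ x, ‖fderiv ℝ φ x‖ₑ ^ 2 ≤ 2 * (‖fderiv ℝ φ x (EuclideanSpace.single 0 1)‖ₑ ^ 2
        + ‖fderiv ℝ φ x (EuclideanSpace.single 1 1)‖ₑ ^ 2) := by
      intro x
      refine le_trans ?_ (add_sq_le_two_mul _ _)
      gcongr
      have := norm_fderiv_le_sum (fderiv ℝ φ x)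
      rw [Fin.sum_univ_two] at this
      simp only [← ofReal_norm]
      rw [← ENNReal.ofReal_add (norm_nonneg _) (norm_nonneg _)]
      exact ENNReal.ofReal_le_ofReal this
    have hzero : ∀ x ∉ Ω, ‖fderiv ℝ φ x‖ₑ ^ 2 = 0 := by
      intro x hx
      have : fderiv ℝ φ x = 0 := image_eq_zero_of_notMem_tsupport fun h =>
        hx (hφ.support (tsupport_fderiv_subset ℝ h))
      rw [this, ← ofReal_norm, norm_zero, ENNReal.ofReal_zero, zero_pow two_ne_zero]
    have hpd : ∀ i : Fin 2, ∫⁻ x in Ω, ‖fderiv ℝ φ x (EuclideanSpace.single i 1)‖ₑ ^ 2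
        = ‖y.snd i‖ₑ ^ 2 := by
      intro i
      rw [enorm_sq_eq_lintegral]
      refine lintegral_congr_ae ?_
      filter_upwards [snd_ae_eq_fderiv hΩ hy hφ hyφ i] with x hx
      rw [hx]
    have hm : Measurable fun x => ‖fderiv ℝ φ x (EuclideanSpace.single 0 1)‖ₑ ^ 2 :=
      ((hφ.fderiv_apply _).smooth.continuous.enorm.measurable).pow_const 2
    have hy2 : ‖y.snd 0‖ₑ ^ 2 + ‖y.snd 1‖ₑ ^ 2 ≤ ‖y‖ₑ ^ 2 := by
      simp only [← ofReal_norm, ← ENNReal.ofReal_pow (norm_nonneg _)]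
      rw [← ENNReal.ofReal_add (by positivity) (by positivity), jet_norm_sq, Fin.sum_univ_two]
      exact ENNReal.ofReal_le_ofReal (le_add_of_nonneg_left (by positivity))
    calc ∫⁻ x, ‖fderiv ℝ φ x‖ₑ ^ 2 = ∫⁻ x in Ω, ‖fderiv ℝ φ x‖ₑ ^ 2 := by
          rw [← lintegral_indicator hΩ.measurableSet]
          refine lintegral_congr fun x => ?_
          by_cases hx : x ∈ Ω
          · rw [indicator_of_mem hx]
          · rw [indicator_of_notMem hx, hzero x hx]
      _ ≤ ∫⁻ x in Ω, 2 * (‖fderiv ℝ φ x (EuclideanSpace.single 0 1)‖ₑ ^ 2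
          + ‖fderiv ℝ φ x (EuclideanSpace.single 1 1)‖ₑ ^ 2) := lintegral_mono fun x => hpt x
      _ = 2 * (‖y.snd 0‖ₑ ^ 2 + ‖y.snd 1‖ₑ ^ 2) := by
          rw [lintegral_const_mul' _ _ (by norm_num), lintegral_add_left hm, hpd, hpd]
      _ ≤ _ := by gcongr
  have hmain := lintegral_enorm_sq_le_of_cover hφ1 hs t' (subset_closure.trans hcov)
    hΩ.measurableSet
  have hmain' : ENNReal.ofReal (V ^ 2 * ‖y.fst‖ ^ 2)
      ≤ ENNReal.ofReal (V ^ 2 * (32 * s ^ 2 * (2 * ‖y‖ ^ 2))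
        + 2 * volume.real Ω * ∑ z ∈ t', ‖Λ z y.fst‖ ^ 2) := by
    have e0 : volume (Metric.ball (0 : Plane) s) = ENNReal.ofReal V :=
      (ofReal_measureReal measure_ball_lt_top.ne).symm
    have e1 : volume Ω = ENNReal.ofReal (volume.real Ω) :=
      (ofReal_measureReal hb.measure_lt_top.ne).symm
    have e2 : ∀ {F : Type} [NormedAddCommGroup F] (v : F), ENNReal.ofReal (‖v‖ ^ 2) = ‖v‖ₑ ^ 2 :=
      fun v => by rw [ENNReal.ofReal_pow (norm_nonneg _), ofReal_norm]
    rw [ENNReal.ofReal_add (by positivity) (by positivity),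
      ENNReal.ofReal_mul (p := V ^ 2) (q := ‖y.fst‖ ^ 2) (by positivity),
      ENNReal.ofReal_mul (p := V ^ 2) (by positivity),
      ENNReal.ofReal_mul (p := 32 * s ^ 2) (by positivity),
      ENNReal.ofReal_mul (p := 2) (q := ‖y‖ ^ 2) (by positivity),
      ENNReal.ofReal_mul (p := 2 * volume.real Ω) (by positivity),
      ENNReal.ofReal_mul (p := 2) (q := volume.real Ω) (by positivity),
      ENNReal.ofReal_sum_of_nonneg fun z _ => by positivity]
    simp only [e2, hΛ, ← e1]
    rw [ENNReal.ofReal_pow hV.le, ← e0, ← hfst, ENNReal.ofReal_ofNat]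
    exact hmain.trans (by gcongr)
  rw [ENNReal.ofReal_le_ofReal_iff (by positivity)] at hmain'
  change ‖y.fst‖ ^ 2 ≤ _
  refine le_of_mul_le_mul_left (hmain'.trans_eq ?_) (by positivity : 0 < V ^ 2)
  rw [← hsε]
  field_simp
  ring

/-- The embedding of `V` with the `H¹` norm into `L²(Ω)²`. -/
def vIncl (Ω : Set Plane) : vJets Ω →L[ℝ] L2 Ω :=
  (WithLp.fstL 2 ℝ (L2 Ω) (PiLp 2 fun _ : Fin 2 => L2 Ω)).comp (vJets Ω).subtypeL

/-- The Rellich theorem for `V`. -/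
theorem isCompactOperator_vIncl (hΩ : IsOpen Ω) (hb : Bornology.IsBounded Ω) :
    IsCompactOperator (vIncl Ω) := by
  refine (isCompactOperator_iff_isCompact_closure_image_closedBall
    (vIncl Ω : vJets Ω →ₗ[ℝ] L2 Ω) one_pos).mpr ?_
  refine TotallyBounded.isCompact_of_isClosed (TotallyBounded.closure ?_) isClosed_closure
  refine Metric.totallyBounded_of_finite_discretization fun ε hε => ?_
  obtain ⟨t, Λ, K, hK, hΛ⟩ := exists_norm_sq_le hΩ hb (ε := ε ^ 2 / 16) (by positivity)
  -- the averages of the elements of the unit ball lie in a compact set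
  let L : L2 Ω →L[ℝ] (t → Plane) := ContinuousLinearMap.pi fun z => Λ z
  have hbdd : Bornology.IsBounded (L '' ((vIncl Ω) '' Metric.closedBall 0 1)) := by
    rw [← image_comp]
    exact (L.comp (vIncl Ω)).lipschitz.isBounded_image Metric.isBounded_closedBall
  have htb : TotallyBounded (L '' ((vIncl Ω) '' Metric.closedBall 0 1)) :=
    hbdd.isCompact_closure.totallyBounded.subset subset_closure
  obtain ⟨η, hη, hηε⟩ : ∃ η : ℝ, 0 < η ∧ K * (t.card * (2 * η) ^ 2) < ε ^ 2 / 2 := by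
    obtain ⟨r, hr, hr2⟩ : ∃ r : ℝ, 0 < r ∧ r ^ 2 = K * t.card + 1 :=
      ⟨√(K * t.card + 1), by positivity, Real.sq_sqrt (by positivity)⟩
    refine ⟨ε / (4 * r), by positivity, ?_⟩
    have h2 : K * (t.card * (2 * (ε / (4 * r))) ^ 2) = K * t.card / r ^ 2 * (ε ^ 2 / 4) := by
      field_simp
      norm_num
    have h3 : K * t.card / r ^ 2 ≤ 1 := by
      rw [div_le_one (by positivity)]; linarith
    rw [h2]
    nlinarith [pow_pos hε 2]
  obtain ⟨T, hT, hcov⟩ := Metric.totallyBounded_iff.mp htb η hη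
  have hex : ∀ v : (vIncl Ω) '' Metric.closedBall 0 1, ∃ p ∈ T, dist (L v) p < η := fun v => by
    simpa using hcov (mem_image_of_mem L v.2)
  choose F hFT hF using hex
  have := hT.fintype
  refine ⟨T, inferInstance, fun v => ⟨F v, hFT v⟩, ?_⟩
  intro v w hvw
  have hLd : dist (L v) (L w) < 2 * η := by
    have hFeq : F v = F w := congrArg Subtype.val hvw
    have h1 := hF v
    rw [hFeq] at h1
    have h2 := hF w
    rw [dist_comm] at h2
    linarith [dist_triangle (L v) (F w) (L w)]
  obtain ⟨_, x, hx, rfl⟩ := v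
  obtain ⟨_, y, hy, rfl⟩ := w
  have hxyn : ‖x - y‖ ≤ 2 := by
    rw [mem_closedBall_zero_iff] at hx hy
    linarith [norm_sub_le x y]
  have hmain := hΛ (x - y : vJets Ω) (x - y).2.1
  have hsum : ∑ z ∈ t, ‖Λ z (vIncl Ω x - vIncl Ω y)‖ ^ 2 ≤ t.card * (2 * η) ^ 2 := by
    rw [← nsmul_eq_mul]
    refine Finset.sum_le_card_nsmul _ _ _ fun z hz => ?_
    gcongr
    have h1 := (norm_le_pi_norm (L (vIncl Ω x) - L (vIncl Ω y)) ⟨z, hz⟩).trans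
      ((dist_eq_norm _ _).symm.le.trans hLd.le)
    rw [← map_sub] at h1
    exact h1
  change dist (vIncl Ω x) (vIncl Ω y) < ε
  rw [dist_eq_norm, ← sq_lt_sq₀ (norm_nonneg _) hε.le]
  change ‖vIncl Ω x - vIncl Ω y‖ ^ 2 ≤ ε ^ 2 / 16 * ‖x - y‖ ^ 2
    + K * ∑ z ∈ t, ‖Λ z (vIncl Ω x - vIncl Ω y)‖ ^ 2 at hmain
  have h4 : ‖x - y‖ ^ 2 ≤ 2 ^ 2 := by gcongr
  have h5 : ε ^ 2 / 16 * ‖x - y‖ ^ 2 ≤ ε ^ 2 / 16 * 2 ^ 2 := by gcongr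
  have h6 := mul_le_mul_of_nonneg_left hsum hK
  nlinarith [pow_pos hε 2]

/-! ### The Poincaré inequality with the smallest Stokes eigenvalue -/

lemma gradInner_self (u : L2 Ω) : gradInner Ω u u = ∑ i, ‖pd Ω i u‖ ^ 2 := by
  simp only [gradInner, real_inner_self_eq_norm_sq]

lemma gradInner_self_nonneg (u : L2 Ω) : 0 ≤ gradInner Ω u u := by
  rw [gradInner_self]
  positivity

lemma nonneg_of_mem_stokesEigenvalues {l : ℝ} (hl : l ∈ stokesEigenvalues Ω) : 0 ≤ l := by
  obtain ⟨w, hw, hw0, h⟩ := hl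
  have h1 := h w hw
  rw [real_inner_self_eq_norm_sq] at h1
  have h2 : 0 < ‖w‖ ^ 2 := by positivity
  exact nonneg_of_mul_nonneg_left (h1 ▸ gradInner_self_nonneg w) h2

lemma memV_vIncl (hΩ : IsOpen Ω) (x : vJets Ω) : MemV Ω (vIncl Ω x) := by
  have h := memV_fst hΩ x.2
  exact h

lemma inner_vJets (hΩ : IsOpen Ω) (x y : vJets Ω) :
    inner ℝ x y = inner ℝ (vIncl Ω x) (vIncl Ω y) + gradInner Ω (vIncl Ω x) (vIncl Ω y) := by
  have hx : ∀ i, (x : Jet Ω).snd i = pd Ω i (vIncl Ω x) := snd_eq_pd hΩ x.2.1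
  have hy : ∀ i, (y : Jet Ω).snd i = pd Ω i (vIncl Ω y) := snd_eq_pd hΩ y.2.1
  rw [Submodule.coe_inner, WithLp.prod_inner_apply]
  simp only [PiLp.inner_apply, gradInner, ← hx, ← hy]
  rfl

/-- A nonzero compact operator `A` attains its norm: `‖A y‖² ≤ μ ‖y‖²` with `μ = ‖A† A‖`, which is
an eigenvalue of `A† A`. -/
lemma exists_eigenvector_of_isCompactOperator {E F : Type*} [NormedAddCommGroup E]
    [InnerProductSpace ℝ E] [CompleteSpace E] [NormedAddCommGroup F] [InnerProductSpace ℝ F]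
    [CompleteSpace F] (A : E →L[ℝ] F) (hA : IsCompactOperator A) {v : E} (hv : A v ≠ 0) :
    ∃ μ : ℝ, 0 < μ ∧ (∀ y, ‖A y‖ ^ 2 ≤ μ * ‖y‖ ^ 2) ∧
      ∃ x, A x ≠ 0 ∧ ∀ y, inner ℝ (A x) (A y) = μ * inner ℝ x y := by
  let T : E →L[ℝ] E := A.adjoint ∘L A
  have hTinner : ∀ x y, inner ℝ (T x) y = inner ℝ (A x) (A y) := fun x y => by
    rw [ContinuousLinearMap.comp_apply, ContinuousLinearMap.adjoint_inner_left]
  have hT : IsCompactOperator T := hA.clm_comp A.adjoint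
  have hsymm : (T : E →ₗ[ℝ] E).IsSymmetric := fun x y => by
    change inner ℝ (T x) y = inner ℝ x (T y)
    rw [← real_inner_comm x (T y), hTinner, hTinner]
    exact real_inner_comm _ _
  have hT0 : T ≠ 0 := by
    intro h
    have h1 := hTinner v v
    rw [h, _root_.zero_apply, inner_zero_left] at h1
    exact hv (inner_self_eq_zero.mp h1.symm)
  have hμ : 0 < ‖T‖ := norm_pos_iff.mpr hT0
  have hnontriv : Nontrivial E := ⟨v, 0, fun h => hv (by rw [h, map_zero])⟩
  have heig : Module.End.HasEigenvalue (T : Module.End ℝ E) ‖T‖ := by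
    rw [hT.hasEigenvalue_iff_mem_spectrum hμ.ne']
    by_contra hres
    obtain ⟨ε, hε, h⟩ := T.rayleighQuotient_le_of_norm_mem_resolventSet
      (𝕜 := ℝ) (by simpa [spectrum] using hres)
    have hnonneg : ∀ x, 0 ≤ T.rayleighQuotient x := fun x => by
      have : T.reApplyInnerSelf x = ‖A x‖ ^ 2 := by
        rw [ContinuousLinearMap.reApplyInnerSelf_apply, hTinner, real_inner_self_eq_norm_sq]
        rfl
      rw [ContinuousLinearMap.rayleighQuotient, this]
      positivity
    have hle : ‖T‖ ≤ ‖T‖ - ε := by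
      conv_lhs => rw [T.norm_eq_iSup_rayleighQuotient hsymm]
      exact ciSup_le fun x => by rw [abs_of_nonneg (hnonneg x)]; exact h x
    linarith
  obtain ⟨x, hx⟩ := heig.exists_hasEigenvector
  have hTx : T x = ‖T‖ • x := hx.apply_eq_smul
  refine ⟨‖T‖, hμ, fun y => ?_, x, fun h => ?_, fun y => ?_⟩
  · calc ‖A y‖ ^ 2 = inner ℝ (T y) y := by rw [hTinner, real_inner_self_eq_norm_sq]
      _ ≤ ‖T y‖ * ‖y‖ := real_inner_le_norm _ _
      _ ≤ ‖T‖ * ‖y‖ * ‖y‖ := by gcongr; exact T.le_opNorm y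
      _ = _ := by ring
  · have h1 := hTinner x x
    rw [h, inner_zero_left, hTx, real_inner_smul_left, real_inner_self_eq_norm_sq] at h1
    have : 0 < ‖x‖ ^ 2 := by have := norm_pos_iff.mpr hx.2; positivity
    exact (mul_pos hμ this).ne' h1
  · rw [← hTinner, hTx, real_inner_smul_left]

set_option maxHeartbeats 800000 in
/-- The Poincaré inequality on `V`. The embedding `J` of `V`, with the `H¹` inner product, into
`L²(Ω)²` is compact, so `μ = ‖J† J‖` is an eigenvalue of `J† J`. Then `1 / μ - 1` is an eigenvalue
of the Stokes operator, and it is the minimum of the Rayleigh quotient `‖∇v‖² / ‖v‖²`. -/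
theorem lambda1_mul_norm_sq_le (hΩ : IsOpen Ω) (hb : Bornology.IsBounded Ω) {v : L2 Ω}
    (hv : MemV Ω v) : lambda1 Ω * ‖v‖ ^ 2 ≤ gradInner Ω v v := by
  rcases eq_or_ne v 0 with rfl | hv0
  · simpa using gradInner_self_nonneg (0 : L2 Ω)
  let j : ∀ w, MemV Ω w → vJets Ω := fun w hw => ⟨jet Ω w, hw.jet_mem⟩
  have hj : ∀ w hw, vIncl Ω (j w hw) = w := fun w hw => rfl
  have hAv : vIncl Ω (j v hv) ≠ 0 := by rwa [hj v hv]
  obtain ⟨μ, hμ, hmax, x, hx0, hx⟩ := exists_eigenvector_of_isCompactOperator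
    (E := vJets Ω) (F := L2 Ω) (vIncl Ω) (isCompactOperator_vIncl hΩ hb) hAv
  have hmem : 1 / μ - 1 ∈ stokesEigenvalues Ω := by
    refine ⟨vIncl Ω x, memV_vIncl hΩ x, hx0, fun w hw => ?_⟩
    have h1 := hx (j w hw)
    rw [inner_vJets hΩ, hj w hw] at h1
    field_simp
    linarith
  have hle : lambda1 Ω ≤ 1 / μ - 1 :=
    csInf_le ⟨0, fun l hl => nonneg_of_mem_stokesEigenvalues hl⟩ hmem
  have hsq := hmax (j v hv)
  rw [← real_inner_self_eq_norm_sq (j v hv), inner_vJets hΩ, hj v hv,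
    real_inner_self_eq_norm_sq] at hsq
  have hfin : (1 / μ - 1) * ‖v‖ ^ 2 ≤ gradInner Ω v v := by
    rw [sub_mul, one_mul, div_mul_eq_mul_div, one_mul, sub_le_iff_le_add, div_le_iff₀ hμ]
    linarith
  exact (mul_le_mul_of_nonneg_right hle (by positivity)).trans hfin

/-- If the time step bound admits a positive step, then the smallest eigenvalue is positive:
it is nonnegative in any case, and the bound is `0` for `λ₁ = 0`, by division by zero. -/
lemma lambda1_pos {θ ν Δt : ℝ} (hΔt : 0 < Δt) (hlt : Δt < dtBound θ ν (lambda1 Ω)) :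
    0 < lambda1 Ω := by
  have h : 0 ≤ lambda1 Ω := Real.sInf_nonneg fun l hl => nonneg_of_mem_stokesEigenvalues hl
  refine h.lt_of_ne fun h0 => ?_
  rw [dtBound, ← h0, mul_zero, div_zero, zero_mul] at hlt
  exact hlt.not_gt hΔt

end DLN

end

theorem mainTheorem3 :
    ∃ Ch Ce : ℝ → ℝ, ∀ θ : ℝ, 0 < θ → θ < 1 →
      DLN.IsHStabConst θ (Ch θ) (Ce θ) ∧
      ∀ (Ω : Set DLN.Plane) (ν Δt : ℝ) (f : ℝ → DLN.L2 Ω) (u : ℕ → DLN.L2 Ω),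
        IsOpen Ω → Bornology.IsBounded Ω → 0 < ν → 0 < Δt →
        MemLp f ∞ ((volume : Measure ℝ).restrict (Ioi 0)) →
        (∀ t : ℝ, 0 < t → ‖f t‖ ≤ DLN.normInf f) →
        0 < DLN.normInf f →
        DLN.IsDLNSolution Ω ν Δt θ f u →
        Δt < DLN.dtBound θ ν (DLN.lambda1 Ω) →
        ∀ N : ℕ, 1 ≤ N →
          ((N : ℝ) - 1) * Δt >
            DLN.Tstar θ (Ch θ) (Ce θ) ν (DLN.lambda1 Ω) (DLN.normInf f)
              (‖u 1‖ ^ 2 + ‖u 0‖ ^ 2) →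
          ‖u N‖ ^ 2 ≤ 2 * DLN.rho0 θ (Ce θ) ν (DLN.lambda1 Ω) (DLN.normInf f) := by
  refine ⟨fun _ => 11, fun _ => 1201, fun θ h0 h1 => ⟨DLN.isHStabConst h0 h1, ?_⟩⟩
  intro Ω ν Δt f u hΩ hb hν hΔt _ hf hM hu hlt N hN hT
  obtain ⟨n, rfl⟩ : ∃ n, N = n + 1 := ⟨N - 1, by omega⟩
  refine hu.norm_sq_le h0 h1 hν hΔt (DLN.lambda1_pos hΔt hlt) hM
    (fun v hv => DLN.lambda1_mul_norm_sq_le hΩ hb hv)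
    (fun v hv => DLN.trilinear_self_eq_zero hΩ hb hv) hf hlt n ?_
  simpa using hT
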